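/- Let $d\ge 1$ and let $\gamma,\beta_1,\dots,\beta_d\ge 0$ satisfy $0<\gamma+\beta_j<1$ for all $1\le j\le d$. Write $\|t\|=\operatorname{dist}(t,\mathbb Z)$ for $t\in\mathbb R$, and let $\mathcal N_\delta(A)$ denote the closed $\delta$-neighborhood of $A\subset\mathbb R^d$ with respect to the maximum norm $\max_j|x_j|$. For a sequence $\{q_i\}_{i\ge 1}$ of positive real numbers put $$E=\bigcap_{i\ge 1}\bigl\{x\in\mathbb R^d:\ \text{there is an integer } 1\le H\le q_i^{\gamma} \text{ such that } \|Hq_i^{\beta_j}x_j\|\le Hq_i^{\beta_j-1}\ \text{for all } 1\le j\le d\bigr\}.$$ Then $$E=\bigcap_{i\ge1}\ \bigcup_{1\le H\le q_i^\gamma}\mathcal N_{q_i^{-1}}\left(\frac{\mathbb Z}{Hq_i^{\beta_1}}\times\cdots\times\frac{\mathbb Z}{Hq_i^{\beta_d}}\right),$$ where $H$ runs over integers, and there exists an increasing sequence $\{q_i\}_{i\ge 1}$ of positive real numbers such that $E$ has Hausdorff dimension $$\min\Bigl\{(d+1)\gamma+\sum_{j=1}^d\beta_j,\ d\Bigr\}.$$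 In particular, $E$ has this Hausdorff dimension for every increasing sequence $\{q_i\}_{i\ge1}$ in $(1,\infty)$ that satisfies $$q_i>\max\bigl\{q_{i-1}^{10di},\ q_{i-1}^{1/(\gamma+\beta_j)}\ (1\le j\le d)\bigr\}\qquad\text{for all } i\ge 2.$$ -/

import Mathlib

noncomputable section

namespace DiophantineLiminf

/-- The distance `‖t‖ = dist(t, ℤ)` of a real number to the nearest integer. -/
def distInt (t : ℝ) : ℝ :=
  Metric.infDist t (Set.range (fun m : ℤ => (m : ℝ)))

/-- The points `x ∈ ℝ^d` such that, for some integer `1 ≤ H ≤ q ^ γ`,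
`‖H q^{β_j} x_j‖ ≤ H q^{β_j - 1}` for all `j` (the same `H` for all coordinates). -/
def approxLevel {d : ℕ} (γ : ℝ) (β : Fin d → ℝ) (q : ℝ) : Set (EuclideanSpace ℝ (Fin d)) :=
  {x | ∃ H : ℕ, 1 ≤ H ∧ (H : ℝ) ≤ q ^ γ ∧
    ∀ j, distInt ((H : ℝ) * q ^ β j * x j) ≤ (H : ℝ) * q ^ (β j - 1)}

/-- The set `⋂_{i ≥ 1} {x : ‖H q_i^{β_j} x_j‖ ≤ H q_i^{β_j - 1} ∀ j, for some 1 ≤ H ≤ q_i^γ}`. -/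
def approxSet {d : ℕ} (γ : ℝ) (β : Fin d → ℝ) (q : ℕ → ℝ) : Set (EuclideanSpace ℝ (Fin d)) :=
  ⋂ i ∈ Set.Ici (1 : ℕ), approxLevel γ β (q i)

/-- The lattice `ℤ/(H q^{β_1}) × ⋯ × ℤ/(H q^{β_d})` in `ℝ^d`. -/
def lattice {d : ℕ} (β : Fin d → ℝ) (q : ℝ) (H : ℕ) : Set (EuclideanSpace ℝ (Fin d)) :=
  {x | ∀ j, ∃ m : ℤ, x j = (m : ℝ) / ((H : ℝ) * q ^ β j)}

/-- The closed `δ`-neighborhood of `A ⊆ ℝ^d` for the maximum norm (so that the neighborhood of a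
point is a closed cube of side `2δ`): `Fin d → ℝ` carries the distance `max_j |x_j - y_j|`. -/
def cubeNhd {d : ℕ} (δ : ℝ) (A : Set (EuclideanSpace ℝ (Fin d))) :
    Set (EuclideanSpace ℝ (Fin d)) :=
  {x | WithLp.ofLp x ∈ Metric.cthickening δ ((fun y => WithLp.ofLp y) '' A : Set (Fin d → ℝ))}

/-- The set `⋂_{i ≥ 1} ⋃_{1 ≤ H ≤ q_i^γ} N_{1/q_i}(ℤ/(H q_i^{β_1}) × ⋯ × ℤ/(H q_i^{β_d}))`. -/
def latticeSet {d : ℕ} (γ : ℝ) (β : Fin d → ℝ) (q : ℕ → ℝ) : Set (EuclideanSpace ℝ (Fin d)) :=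
  ⋂ i ∈ Set.Ici (1 : ℕ), ⋃ H ∈ {H : ℕ | 1 ≤ H ∧ (H : ℝ) ≤ q i ^ γ},
    cubeNhd (q i)⁻¹ (lattice β (q i) H)

/-- The explicit growth condition on `q_1 < q_2 < ⋯` in `(1, ∞)`:
`q_i > max {q_{i-1}^{10 d i}, q_{i-1}^{1/(γ+β_j)}, 1 ≤ j ≤ d}` for all `i ≥ 2`
(written with `i + 1` in place of `i`). -/
def GrowsFast {d : ℕ} (γ : ℝ) (β : Fin d → ℝ) (q : ℕ → ℝ) : Prop :=
  (∀ i, 1 ≤ i → 1 < q i) ∧ StrictMonoOn q (Set.Ici 1) ∧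
    ∀ i, 1 ≤ i → q i ^ (10 * d * (i + 1)) < q (i + 1) ∧
      ∀ j, q i ^ (1 / (γ + β j)) < q (i + 1)

end DiophantineLiminf

end

/-
In the maximum norm the set is a liminf set of cubes of side `2 / q i`, centred at fractions whose
`j`-th coordinate lies in `ℤ / (H q ^ β j)`, `H ≤ q ^ γ`. In a bounded region there are about
`q ^ ((d + 1) γ + ∑ j, β j)` such cubes, and this cover gives the upper bound.

For the lower bound keep only prime denominators between `q ^ γ'` and `q ^ γ`, with `γ' < γ`
close to `γ` (only `H = 1` if `γ = 0`), and numerators prime to `H`. Two such fractions with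
distinct denominators `H`, `H'` are distinct in every coordinate, and there are few pairs at a given
distance because `p H' - p' H` is a nonzero integer which, with `H` and `H'`, determines `p` modulo
`H`. So the fractions in a cube have small energy at every scale, and by pigeonhole at least half of
them form a `t`-regular family. Nesting such families, for a sequence `q` that grows
superpolynomially, yields a Cantor set inside the liminf set. Its Hausdorff measure is bounded below
as follows: given a cover, one descends from each cube to a child along which the potential
`∑ diam ^ τ` of the cover does not increase.
-/

open Set Filter Topology MeasureTheory Measure
open scoped NNReal ENNReal

namespace DiophantineLiminf

section LatticeDescription

theorem distInt_le_iff {t r : ℝ} : distInt t ≤ r ↔ ∃ m : ℤ, |t - m| ≤ r := by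
  constructor
  · intro h
    obtain ⟨_, ⟨m, rfl⟩, hm⟩ :=
      Int.isClosedEmbedding_coe_real.isClosed_range.exists_infDist_eq_dist (range_nonempty _) t
    exact ⟨m, by rwa [← Real.dist_eq, ← hm]⟩
  · rintro ⟨m, hm⟩
    exact (Metric.infDist_le_dist_of_mem (mem_range_self m)).trans (by rwa [Real.dist_eq])

theorem distInt_mul_le_iff {D x δ : ℝ} (hD : 0 < D) :
    distInt (D * x) ≤ D * δ ↔ ∃ m : ℤ, |x - m / D| ≤ δ := by
  refine distInt_le_iff.trans (exists_congr fun m => ?_)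
  rw [show D * x - m = D * (x - m / D) by field_simp, abs_mul, abs_of_pos hD,
    mul_le_mul_iff_right₀ hD]

variable {d : ℕ} {γ : ℝ} {β : Fin d → ℝ} {q : ℝ} {H : ℕ} {x : EuclideanSpace ℝ (Fin d)}

theorem mem_approxLevel_iff (hq : 0 < q) :
    x ∈ approxLevel γ β q ↔ ∃ H : ℕ, 1 ≤ H ∧ (H : ℝ) ≤ q ^ γ ∧
      ∃ p : Fin d → ℤ, ∀ j, |x j - p j / (H * q ^ β j)| ≤ q⁻¹ := by
  refine exists_congr fun H => and_congr_right fun hH => and_congr_right fun _ => ?_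
  have hH0 : (0 : ℝ) < H := by exact_mod_cast hH
  refine Iff.trans (forall_congr' fun j => ?_)
    (Classical.skolem (p := fun j (m : ℤ) => |x j - m / (H * q ^ β j)| ≤ q⁻¹))
  have hD : 0 < (H : ℝ) * q ^ β j := mul_pos hH0 (Real.rpow_pos_of_pos hq _)
  rw [← distInt_mul_le_iff hD, Real.rpow_sub_one hq.ne', div_eq_mul_inv, mul_assoc (H : ℝ) _ q⁻¹]

theorem exists_lattice_coord_of_mem_cubeNhd (hq : 0 < q) (hH : 1 ≤ H)
    (hx : x ∈ cubeNhd q⁻¹ (lattice β q H)) (j : Fin d) :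
    ∃ m : ℤ, |x j - m / (H * q ^ β j)| ≤ q⁻¹ := by
  have hH0 : (0 : ℝ) < H := by exact_mod_cast hH
  have hD : 0 < (H : ℝ) * q ^ β j := mul_pos hH0 (Real.rpow_pos_of_pos hq _)
  rw [← distInt_mul_le_iff hD]
  refine le_of_forall_pos_le_add fun ε hε => ?_
  have hthick : WithLp.ofLp x ∈ Metric.thickening (q⁻¹ + ε / (H * q ^ β j))
      ((fun y => WithLp.ofLp y) '' lattice β q H : Set (Fin d → ℝ)) :=
    Metric.cthickening_subset_thickening' (by positivity)
      (lt_add_of_pos_right _ (by positivity)) _ hx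
  obtain ⟨_, ⟨y, hy, rfl⟩, hxy⟩ := Metric.mem_thickening_iff.1 hthick
  obtain ⟨m, hm⟩ := hy j
  have hclose : |x j - m / (H * q ^ β j)| ≤ q⁻¹ + ε / (H * q ^ β j) := by
    rw [← hm, ← Real.dist_eq]
    exact (dist_le_pi_dist (WithLp.ofLp x) (WithLp.ofLp y) j).trans hxy.le
  refine ((distInt_mul_le_iff hD).2 ⟨m, hclose⟩).trans_eq ?_
  field_simp

theorem mem_cubeNhd_lattice_iff (hq : 0 < q) (hH : 1 ≤ H) :
    x ∈ cubeNhd q⁻¹ (lattice β q H) ↔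
      ∃ p : Fin d → ℤ, ∀ j, |x j - p j / (H * q ^ β j)| ≤ q⁻¹ := by
  constructor
  · exact fun hx => Classical.skolem.1 (exists_lattice_coord_of_mem_cubeNhd hq hH hx)
  · rintro ⟨p, hp⟩
    refine Metric.mem_cthickening_of_dist_le (WithLp.ofLp x) (fun j => p j / (H * q ^ β j)) _ _
      ⟨WithLp.toLp 2 fun j => p j / (H * q ^ β j), fun j => ⟨p j, rfl⟩, rfl⟩ ?_
    exact (dist_pi_le_iff (by positivity)).2 fun j => by rw [Real.dist_eq]; exact hp j

theorem approxSet_eq_latticeSet {q : ℕ → ℝ} (hq : ∀ i, 1 ≤ i → 0 < q i) :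
    approxSet γ β q = latticeSet γ β q := by
  refine iInter₂_congr fun i hi => ?_
  ext x
  rw [mem_approxLevel_iff (hq i hi)]
  simp only [mem_iUnion, mem_ofPred_eq, exists_prop, and_assoc]
  exact exists_congr fun H => and_congr_right fun hH => and_congr_right fun _ =>
    (mem_cubeNhd_lattice_iff (hq i hi) hH).symm

end LatticeDescription

section MaximumNorm

variable {d : ℕ}

/-- The point of `ℝ^d` with coordinates `p_j / (H w_j)`; for `w_j = q ^ β_j` these are the points
of the lattice with denominator `H`. -/
noncomputable def fracPoint (w : Fin d → ℝ) (H : ℕ) (p : Fin d → ℤ) : Fin d → ℝ :=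
  fun j => p j / (H * w j)

/-- One level of the approximation set in `ℝ^d` with the maximum norm, as a union of cubes of
half-side `q⁻¹`. -/
def cubeLevel (γ : ℝ) (β : Fin d → ℝ) (q : ℝ) : Set (Fin d → ℝ) :=
  {x | ∃ H : ℕ, 1 ≤ H ∧ (H : ℝ) ≤ q ^ γ ∧
    ∃ p : Fin d → ℤ, x ∈ Metric.closedBall (fracPoint (fun j => q ^ β j) H p) q⁻¹}

/-- The approximation set, as a subset of `ℝ^d` with the maximum norm. -/
def cubeSet (γ : ℝ) (β : Fin d → ℝ) (q : ℕ → ℝ) : Set (Fin d → ℝ) :=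
  ⋂ i ∈ Ici (1 : ℕ), cubeLevel γ β (q i)

variable {γ : ℝ} {β : Fin d → ℝ}

theorem preimage_cubeLevel {q : ℝ} (hq : 0 < q) :
    EuclideanSpace.equiv (Fin d) ℝ ⁻¹' cubeLevel γ β q = approxLevel γ β q := by
  ext x
  rw [mem_approxLevel_iff hq]
  simp only [mem_preimage, cubeLevel, mem_ofPred_eq, Metric.mem_closedBall,
    dist_pi_le_iff (inv_nonneg.2 hq.le), Real.dist_eq]
  rfl

theorem dimH_approxSet {q : ℕ → ℝ} (hq : ∀ i, 1 ≤ i → 0 < q i) :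
    dimH (approxSet γ β q) = dimH (cubeSet γ β q) := by
  rw [← (EuclideanSpace.equiv (Fin d) ℝ).dimH_preimage, cubeSet, preimage_iInter₂]
  exact congrArg dimH (iInter₂_congr fun i hi => (preimage_cubeLevel (hq i hi)).symm)

end MaximumNorm

section UpperBound

variable {d : ℕ}

/-- The exponent `(d + 1) γ + ∑ j, β j`: there are about `q ^ countExponent γ β` pairs of a
denominator `H ≤ q ^ γ` and a point of the corresponding lattice in the unit cube. -/
def countExponent (γ : ℝ) (β : Fin d → ℝ) : ℝ := (d + 1) * γ + ∑ j, β j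

theorem rpow_countExponent (γ : ℝ) (β : Fin d → ℝ) {q : ℝ} (hq : 0 < q) :
    q ^ countExponent γ β = q ^ γ * ∏ j, q ^ (γ + β j) := by
  rw [← Real.rpow_sum_of_pos hq, ← Real.rpow_add hq, Finset.sum_add_distrib, countExponent]
  congr 1
  simp only [Finset.sum_const, Finset.card_univ, Fintype.card_fin, nsmul_eq_mul]
  ring

theorem mem_Icc_floor_iff {x : ℝ} {m : ℤ} : m ∈ Finset.Icc (-⌊x⌋) ⌊x⌋ ↔ |(m : ℝ)| ≤ x := by
  rw [Finset.mem_Icc, neg_le, Int.le_floor, Int.le_floor, abs_le, Int.cast_neg, neg_le]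

theorem card_Icc_floor_le {x : ℝ} (hx : 0 ≤ x) :
    ((Finset.Icc (-⌊x⌋) ⌊x⌋).card : ℝ) ≤ 2 * x + 1 := by
  have hfloor : 0 ≤ ⌊x⌋ := Int.floor_nonneg.2 hx
  have hcard : ((Finset.Icc (-⌊x⌋) ⌊x⌋).card : ℝ) = ⌊x⌋ + 1 - -⌊x⌋ := by
    exact_mod_cast Int.card_Icc_of_le (-⌊x⌋) ⌊x⌋ (by omega)
  linarith [Int.floor_le x]

/-- Indices `(H, p)` of the cubes of one level that can meet the cube of half-side `R` around the
origin. -/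
noncomputable def coverIndices (γ : ℝ) (β : Fin d → ℝ) (R q : ℝ) : Finset (ℕ × (Fin d → ℤ)) :=
  Finset.Icc 1 ⌊q ^ γ⌋₊ ×ˢ Fintype.piFinset fun j =>
    Finset.Icc (-⌊(R + 1) * q ^ (γ + β j)⌋) ⌊(R + 1) * q ^ (γ + β j)⌋

variable {γ : ℝ} {β : Fin d → ℝ} {q R : ℝ}

theorem abs_numerator_le {H : ℕ} {p : Fin d → ℤ} {x : Fin d → ℝ} (hq : 1 ≤ q) (hH : 1 ≤ H)
    (hHq : (H : ℝ) ≤ q ^ γ) (hp : x ∈ Metric.closedBall (fracPoint (fun j => q ^ β j) H p) q⁻¹)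
    (hx : x ∈ Metric.closedBall 0 R) (j : Fin d) : |(p j : ℝ)| ≤ (R + 1) * q ^ (γ + β j) := by
  have hq0 : 0 < q := by linarith
  have hD : 0 < (H : ℝ) * q ^ β j :=
    mul_pos (by exact_mod_cast hH) (Real.rpow_pos_of_pos hq0 _)
  have hfrac : |(p j : ℝ) / (H * q ^ β j)| ≤ R + 1 := by
    have hnorm : ‖fracPoint (fun j => q ^ β j) H p‖ ≤ R + 1 := by
      rw [← dist_zero_right]
      refine (dist_triangle_left _ _ x).trans ?_
      linarith [Metric.mem_closedBall.1 hp, Metric.mem_closedBall.1 hx,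
        inv_le_one_of_one_le₀ hq]
    exact (norm_le_pi_norm _ j).trans hnorm
  rw [abs_div, abs_of_pos hD, div_le_iff₀ hD] at hfrac
  refine hfrac.trans ?_
  rw [Real.rpow_add hq0]
  have hR : 0 ≤ R := dist_nonneg.trans (Metric.mem_closedBall.1 hx)
  gcongr

theorem cubeLevel_inter_closedBall_subset (hq : 1 ≤ q) :
    cubeLevel γ β q ∩ Metric.closedBall 0 R ⊆
      ⋃ a : coverIndices γ β R q,
        Metric.closedBall (fracPoint (fun j => q ^ β j) a.1.1 a.1.2) q⁻¹ := by
  rintro x ⟨⟨H, hH, hHq, p, hp⟩, hxR⟩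
  have hmem : (H, p) ∈ coverIndices γ β R q := by
    rw [coverIndices, Finset.mem_product, Finset.mem_Icc, Fintype.mem_piFinset]
    exact ⟨⟨hH, Nat.le_floor hHq⟩,
      fun j => mem_Icc_floor_iff.2 (abs_numerator_le hq hH hHq hp hxR j)⟩
  exact mem_iUnion.2 ⟨⟨(H, p), hmem⟩, hp⟩

theorem card_coverIndices_le (hβ : ∀ j, 0 ≤ γ + β j) (hq : 1 ≤ q) (hR : 0 ≤ R) :
    ((coverIndices γ β R q).card : ℝ) ≤ (2 * R + 3) ^ d * q ^ countExponent γ β := by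
  have hq0 : 0 < q := by linarith
  rw [coverIndices, Finset.card_product, Fintype.card_piFinset, Nat.card_Icc, Nat.add_sub_cancel]
  push_cast
  have hnum : ∀ j ∈ Finset.univ, ((Finset.Icc (-⌊(R + 1) * q ^ (γ + β j)⌋)
      ⌊(R + 1) * q ^ (γ + β j)⌋).card : ℝ) ≤ (2 * R + 3) * q ^ (γ + β j) := by
    intro j _
    refine (card_Icc_floor_le (by positivity)).trans ?_
    linarith [Real.one_le_rpow hq (hβ j)]
  calc _ ≤ q ^ γ * ∏ j, ((2 * R + 3) * q ^ (γ + β j)) :=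
        mul_le_mul (Nat.floor_le (by positivity))
          (Finset.prod_le_prod (fun _ _ => by positivity) hnum) (by positivity) (by positivity)
    _ = _ := by
        rw [Finset.prod_mul_distrib, Finset.prod_const, Finset.card_univ, Fintype.card_fin,
          rpow_countExponent γ β hq0]
        ring

theorem ediam_closedBall_le_ofReal {X : Type*} [PseudoMetricSpace X] (x : X) (r : ℝ) :
    Metric.ediam (Metric.closedBall x r) ≤ ENNReal.ofReal (2 * r) :=
  Metric.ediam_le_of_forall_dist_le fun y hy z hz => by
    linarith [dist_triangle_right y z x, Metric.mem_closedBall.1 hy, Metric.mem_closedBall.1 hz]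

theorem sum_ediam_cover_le {t : ℝ} (ht : 0 ≤ t) (hβ : ∀ j, 0 ≤ γ + β j) (hq : 1 ≤ q)
    (hR : 0 ≤ R) :
    ∑ a : coverIndices γ β R q,
        Metric.ediam (Metric.closedBall (fracPoint (fun j => q ^ β j) a.1.1 a.1.2) q⁻¹) ^ t ≤
      ENNReal.ofReal ((2 * R + 3) ^ d * 2 ^ t * q ^ (-(t - countExponent γ β))) := by
  have hq0 : 0 < q := by linarith
  refine (Finset.sum_le_card_nsmul _ _ (ENNReal.ofReal (2 * q⁻¹) ^ t)
    fun a _ => ENNReal.rpow_le_rpow (ediam_closedBall_le_ofReal _ _) ht).trans ?_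
  rw [ENNReal.ofReal_rpow_of_pos (by positivity), nsmul_eq_mul, ← ENNReal.ofReal_natCast,
    ← ENNReal.ofReal_mul (by positivity), Finset.card_univ, Fintype.card_coe]
  refine ENNReal.ofReal_le_ofReal ?_
  refine (mul_le_mul_of_nonneg_right (card_coverIndices_le hβ hq hR) (by positivity)).trans_eq ?_
  rw [Real.mul_rpow (by norm_num) (by positivity), Real.inv_rpow hq0.le, neg_sub,
    Real.rpow_sub hq0]
  ring

variable {q : ℕ → ℝ}

theorem hausdorffMeasure_cubeSet_inter_closedBall {t : ℝ} (ht0 : 0 ≤ t)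
    (ht : countExponent γ β < t) (hβ : ∀ j, 0 ≤ γ + β j) (hq : Tendsto q atTop atTop)
    (hR : 0 ≤ R) : μH[t] (cubeSet γ β q ∩ Metric.closedBall 0 R) = 0 := by
  have hdiam : Tendsto (fun i => ENNReal.ofReal (2 * (q i)⁻¹)) atTop (𝓝 0) := by
    have := ENNReal.tendsto_ofReal ((tendsto_inv_atTop_zero.comp hq).const_mul 2)
    simpa only [Function.comp_apply, mul_zero, ENNReal.ofReal_zero] using this
  have hsum : Tendsto (fun i => ENNReal.ofReal
      ((2 * R + 3) ^ d * 2 ^ t * q i ^ (-(t - countExponent γ β)))) atTop (𝓝 0) := by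
    have := ENNReal.tendsto_ofReal
      (((tendsto_rpow_neg_atTop (sub_pos.2 ht)).comp hq).const_mul ((2 * R + 3) ^ d * 2 ^ t))
    simpa only [Function.comp_apply, mul_zero, ENNReal.ofReal_zero] using this
  have hlevel : ∀ᶠ i in atTop, 1 ≤ i ∧ 1 ≤ q i :=
    (eventually_ge_atTop 1).and (hq.eventually_ge_atTop 1)
  refine le_antisymm ?_ zero_le
  refine (hausdorffMeasure_le_liminf_sum t _ _ hdiam
    (fun i (a : coverIndices γ β R (q i)) =>
      Metric.closedBall (fracPoint (fun j => q i ^ β j) a.1.1 a.1.2) (q i)⁻¹) ?_ ?_).trans ?_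
  · exact Eventually.of_forall fun i a => ediam_closedBall_le_ofReal _ _
  · filter_upwards [hlevel] with i ⟨hi, hqi⟩
    exact (inter_subset_inter_left _ (iInter₂_subset i hi)).trans
      (cubeLevel_inter_closedBall_subset hqi)
  · rw [← hsum.liminf_eq]
    refine liminf_le_liminf ?_
    filter_upwards [hlevel] with i ⟨_, hqi⟩ using sum_ediam_cover_le ht0 hβ hqi hR

theorem dimH_cubeSet_le (hs : 0 ≤ countExponent γ β) (hβ : ∀ j, 0 ≤ γ + β j)
    (hq : Tendsto q atTop atTop) :
    dimH (cubeSet γ β q) ≤ ENNReal.ofReal (countExponent γ β) := by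
  have hU : cubeSet γ β q = ⋃ N : ℕ, cubeSet γ β q ∩ Metric.closedBall 0 N := by
    rw [← inter_iUnion, Metric.iUnion_closedBall_nat, inter_univ]
  rw [hU, dimH_iUnion]
  refine iSup_le fun N => le_of_forall_gt_imp_ge_of_dense fun a ha => ?_
  obtain ⟨t, hst, hta⟩ := ENNReal.lt_iff_exists_nnreal_btwn.1 ha
  rw [← ENNReal.ofReal_coe_nnreal, ENNReal.ofReal_lt_ofReal_iff_of_nonneg hs] at hst
  refine (dimH_le_of_hausdorffMeasure_ne_top ?_).trans hta.le
  rw [hausdorffMeasure_cubeSet_inter_closedBall t.coe_nonneg hst hβ hq N.cast_nonneg]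
  exact ENNReal.zero_ne_top

end UpperBound

section Potential

/-- The weight, at scale `ρ`, of a set of diameter at most `r`. -/
noncomputable def weight (C τ ρ r : ℝ) : ℝ := min 1 (C * (r / ρ) ^ τ)

theorem weight_nonneg {C τ ρ r : ℝ} (hC : 0 ≤ C) (hρ : 0 ≤ ρ) (hr : 0 ≤ r) :
    0 ≤ weight C τ ρ r := le_min zero_le_one (by positivity)

theorem mul_rpow_max_mul_weight_le {C t τ ρ ρ' r : ℝ} (hC : 1 ≤ C) (hτt : τ ≤ t)
    (hρ : 0 < ρ) (hρ' : 0 < ρ') (hr : 0 < r) (hrρ : r ≤ ρ)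
    (hsmall : C * (ρ' / ρ) ^ (t - τ) ≤ 1) :
    C * (max r ρ' / ρ) ^ t * weight C τ ρ' r ≤ C * (r / ρ) ^ τ := by
  rcases le_total ρ' r with hr' | hr'
  · calc C * (max r ρ' / ρ) ^ t * weight C τ ρ' r ≤ C * (r / ρ) ^ t * 1 := by
          rw [max_eq_left hr']
          gcongr
          exact min_le_left _ _
      _ ≤ C * (r / ρ) ^ τ := by
          rw [mul_one]
          gcongr C * ?_
          exact Real.rpow_le_rpow_of_exponent_ge (by positivity) ((div_le_one hρ).2 hrρ) hτt
  · have hsplit : (ρ' / ρ) ^ t * (r / ρ') ^ τ = (ρ' / ρ) ^ (t - τ) * (r / ρ) ^ τ := by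
      rw [show r / ρ = ρ' / ρ * (r / ρ') by field_simp,
        Real.mul_rpow (by positivity) (by positivity), ← mul_assoc,
        ← Real.rpow_add (by positivity), sub_add_cancel]
    calc C * (max r ρ' / ρ) ^ t * weight C τ ρ' r ≤ C * (ρ' / ρ) ^ t * (C * (r / ρ') ^ τ) := by
          rw [max_eq_right hr']
          gcongr
          exact min_le_right _ _
      _ = C * (ρ' / ρ) ^ (t - τ) * (C * (r / ρ) ^ τ) := by linear_combination C * C * hsplit
      _ ≤ 1 * (C * (r / ρ) ^ τ) := by gcongr
      _ = C * (r / ρ) ^ τ := one_mul _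

theorem card_mul_weight_le {C t τ ρ ρ' r n m : ℝ} (hC : 1 ≤ C) (hτ : 0 < τ) (hτt : τ ≤ t)
    (hρ : 0 < ρ) (hρ' : 0 < ρ') (hr : 0 < r) (hsmall : C * (ρ' / ρ) ^ (t - τ) ≤ 1)
    (hm : 0 ≤ m) (hmn : m ≤ n) (h : m ≤ C * n * (max r ρ' / ρ) ^ t) :
    m * weight C τ ρ' r ≤ n * weight C τ ρ r := by
  have hn : 0 ≤ n := hm.trans hmn
  have hweight : 0 ≤ weight C τ ρ' r := weight_nonneg (by linarith) hρ'.le hr.le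
  have htrivial : m * weight C τ ρ' r ≤ n * 1 :=
    mul_le_mul hmn (min_le_left _ _) hweight hn
  rw [weight, weight, mul_min_of_nonneg _ _ hn]
  refine le_min htrivial ?_
  rcases le_total ρ r with hρr | hrρ
  · have : 1 ≤ C * (r / ρ) ^ τ :=
      one_le_mul_of_one_le_of_one_le hC (Real.one_le_rpow ((one_le_div hρ).2 hρr) hτ.le)
    exact htrivial.trans (by gcongr)
  · calc m * weight C τ ρ' r ≤ C * n * (max r ρ' / ρ) ^ t * weight C τ ρ' r := by gcongr
      _ = n * (C * (max r ρ' / ρ) ^ t * weight C τ ρ' r) := by ring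
      _ ≤ n * (C * (r / ρ) ^ τ) := mul_le_mul_of_nonneg_left
          (mul_rpow_max_mul_weight_le hC hτt hρ hρ' hr hrρ hsmall) hn

variable {X ι : Type*} [PseudoMetricSpace X]

open Classical in
/-- The total weight at scale `ρ` of those sets of a family that meet the ball of radius `ρ`
around `c`. It replaces the mass of the ball in the mass distribution principle. -/
noncomputable def potential (C τ : ℝ) (U : ℕ → Set X) (r : ℕ → ℝ) (ρ : ℝ) (c : X) : ℝ≥0∞ :=
  ∑' n, if (Metric.closedBall c ρ ∩ U n).Nonempty then ENNReal.ofReal (weight C τ ρ (r n)) else 0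

open Classical in
/-- The ball of radius `ρ` around `c` contains balls of radius `ρ'` inside the set `F`, indexed by
a finite set, that are distributed in a `t`-dimensional way down to the scale `ρ'`. -/
def HasChildren (ι : Type*) (C t ρ ρ' : ℝ) (F : Set X) (c : X) : Prop :=
  ∃ (S : Finset ι) (y : ι → X), S.Nonempty ∧
    (∀ a ∈ S, Metric.closedBall (y a) ρ' ⊆ Metric.closedBall c ρ ∩ F) ∧
    ∀ (U : Set X) (r : ℝ), 0 < r → (∀ u ∈ U, ∀ v ∈ U, dist u v ≤ r) →
      ((S.filter fun a => (Metric.closedBall (y a) ρ' ∩ U).Nonempty).card : ℝ) ≤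
        C * S.card * (max r ρ' / ρ) ^ t

variable {C t τ : ℝ} {U : ℕ → Set X} {r : ℕ → ℝ}

/- On average over the children, the potential does not increase. -/
theorem HasChildren.exists_potential_le {ρ ρ' : ℝ} {F : Set X} {c : X}
    (h : HasChildren ι C t ρ ρ' F c) (hC : 1 ≤ C) (hτ : 0 < τ) (hτt : τ ≤ t)
    (hρ : 0 < ρ) (hρ' : 0 < ρ') (hsmall : C * (ρ' / ρ) ^ (t - τ) ≤ 1) (hr : ∀ n, 0 < r n)
    (hU : ∀ n, ∀ u ∈ U n, ∀ v ∈ U n, dist u v ≤ r n) :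
    ∃ c', Metric.closedBall c' ρ' ⊆ Metric.closedBall c ρ ∩ F ∧
      potential C τ U r ρ' c' ≤ potential C τ U r ρ c := by
  classical
  obtain ⟨S, y, hS, hsub, hcount⟩ := h
  suffices hsum : ∑ a ∈ S, potential C τ U r ρ' (y a) ≤ ∑ _a ∈ S, potential C τ U r ρ c by
    obtain ⟨a, ha, hle⟩ := ENNReal.exists_le_of_sum_le hS hsum
    exact ⟨y a, hsub a ha, hle⟩
  simp only [potential]
  rw [← Summable.tsum_finsetSum fun _ _ => ENNReal.summable, Finset.sum_const, nsmul_eq_mul,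
    ← ENNReal.tsum_mul_left]
  refine ENNReal.tsum_le_tsum fun n => ?_
  rw [← Finset.sum_filter, Finset.sum_const, nsmul_eq_mul]
  by_cases hmeet : (Metric.closedBall c ρ ∩ U n).Nonempty
  · rw [if_pos hmeet, ← ENNReal.ofReal_natCast, ← ENNReal.ofReal_natCast,
      ← ENNReal.ofReal_mul (by positivity), ← ENNReal.ofReal_mul (by positivity)]
    exact ENNReal.ofReal_le_ofReal (card_mul_weight_le hC hτ hτt hρ hρ' (hr n) hsmall
      (by positivity) (by exact_mod_cast Finset.card_filter_le _ _) (hcount _ _ (hr n) (hU n)))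
  · have hnone : S.filter (fun a => (Metric.closedBall (y a) ρ' ∩ U n).Nonempty) = ∅ :=
      Finset.filter_eq_empty_iff.2 fun a ha hne => hmeet
        (hne.mono (inter_subset_inter_left _ ((hsub a ha).trans inter_subset_left)))
    simp [hnone]

variable {ρ : ℕ → ℝ} {F : ℕ → Set X}

theorem exists_nested_closedBall (hC : 1 ≤ C) (hτ : 0 < τ) (hτt : τ ≤ t) (hρ : ∀ i, 0 < ρ i)
    (hsmall : ∀ i, C * (ρ (i + 1) / ρ i) ^ (t - τ) ≤ 1)
    (hchild : ∀ i c, HasChildren ι C t (ρ i) (ρ (i + 1)) (F i) c) (x₀ : X) (hr : ∀ n, 0 < r n)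
    (hU : ∀ n, ∀ u ∈ U n, ∀ v ∈ U n, dist u v ≤ r n) :
    ∃ c : ℕ → X, c 0 = x₀ ∧ (∀ i, Metric.closedBall (c (i + 1)) (ρ (i + 1)) ⊆
      Metric.closedBall (c i) (ρ i) ∩ F i) ∧
      ∀ i, potential C τ U r (ρ i) (c i) ≤ potential C τ U r (ρ 0) x₀ := by
  have hstep : ∀ i c, ∃ c', Metric.closedBall c' (ρ (i + 1)) ⊆ Metric.closedBall c (ρ i) ∩ F i ∧
      potential C τ U r (ρ (i + 1)) c' ≤ potential C τ U r (ρ i) c := fun i c =>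
    (hchild i c).exists_potential_le hC hτ hτt (hρ i) (hρ _) (hsmall i) hr hU
  choose next hnext hpot using hstep
  refine ⟨fun n => Nat.rec x₀ next n, rfl, fun i => hnext i _, fun i => ?_⟩
  induction i with
  | zero => exact le_rfl
  | succ i ih => exact (hpot i _).trans ih

theorem nonempty_iInter_closedBall [CompleteSpace X] {c : ℕ → X} (hρ : ∀ i, 0 ≤ ρ i)
    (hρ0 : Tendsto ρ atTop (𝓝 0))
    (hc : ∀ i, Metric.closedBall (c (i + 1)) (ρ (i + 1)) ⊆ Metric.closedBall (c i) (ρ i)) :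
    (⋂ i, Metric.closedBall (c i) (ρ i)).Nonempty := by
  refine Metric.nonempty_iInter_of_nonempty_biInter (fun _ => Metric.isClosed_closedBall)
    (fun _ => Metric.isBounded_closedBall) (fun N => ⟨c N, mem_iInter₂.2 fun n hn => ?_⟩) ?_
  · exact antitone_nat_of_succ_le (f := fun i => Metric.closedBall (c i) (ρ i)) hc hn
      (Metric.mem_closedBall_self (hρ N))
  · refine squeeze_zero (fun _ => Metric.diam_nonneg) (fun i => Metric.diam_closedBall (hρ i)) ?_
    simpa only [mul_zero] using hρ0.const_mul 2

theorem one_le_tsum_weight [CompleteSpace X] (hC : 1 ≤ C) (hτ : 0 < τ) (hτt : τ ≤ t)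
    (hρ : ∀ i, 0 < ρ i) (hρ0 : Tendsto ρ atTop (𝓝 0))
    (hsmall : ∀ i, C * (ρ (i + 1) / ρ i) ^ (t - τ) ≤ 1)
    (hchild : ∀ i c, HasChildren ι C t (ρ i) (ρ (i + 1)) (F i) c) (x₀ : X) (hr : ∀ n, 0 < r n)
    (hU : ∀ n, ∀ u ∈ U n, ∀ v ∈ U n, dist u v ≤ r n)
    (hcov : Metric.closedBall x₀ (ρ 0) ∩ ⋂ i, F i ⊆ ⋃ n, U n) :
    1 ≤ ∑' n, ENNReal.ofReal (weight C τ (ρ 0) (r n)) := by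
  classical
  obtain ⟨c, hc0, hc, hpot⟩ := exists_nested_closedBall hC hτ hτt hρ hsmall hchild x₀ hr hU
  obtain ⟨x, hx⟩ := nonempty_iInter_closedBall (fun i => (hρ i).le) hρ0
    fun i => (hc i).trans inter_subset_left
  rw [mem_iInter] at hx
  obtain ⟨n, hn⟩ := mem_iUnion.1 (hcov ⟨hc0 ▸ hx 0, mem_iInter.2 fun i => (hc i (hx (i + 1))).2⟩)
  -- Once `ρ i` is smaller than `r n`, the set `U n` alone has weight one.
  obtain ⟨i, hi⟩ := (hρ0.eventually (gt_mem_nhds (hr n))).exists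
  have hweight : weight C τ (ρ i) (r n) = 1 :=
    min_eq_left (one_le_mul_of_one_le_of_one_le hC
      (Real.one_le_rpow ((one_le_div (hρ i)).2 hi.le) hτ.le))
  calc 1 = ENNReal.ofReal (weight C τ (ρ i) (r n)) := by rw [hweight, ENNReal.ofReal_one]
    _ = if (Metric.closedBall (c i) (ρ i) ∩ U n).Nonempty
          then ENNReal.ofReal (weight C τ (ρ i) (r n)) else 0 := (if_pos ⟨x, hx i, hn⟩).symm
    _ ≤ potential C τ U r (ρ i) (c i) := ENNReal.le_tsum n
    _ ≤ potential C τ U r (ρ 0) x₀ := hpot i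
    _ ≤ _ := ENNReal.tsum_le_tsum fun n => by split_ifs <;> simp

end Potential

section HausdorffMeasure

variable {X ι : Type*} [MetricSpace X] [MeasurableSpace X] [BorelSpace X] {C t τ : ℝ} {E : Set X}

theorem exists_cover_ediam_of_hausdorffMeasure_eq_zero (h : μH[τ] E = 0) {ε : ℝ≥0∞}
    (hε : 0 < ε) :
    ∃ T : ℕ → Set X, E ⊆ ⋃ n, T n ∧ (∀ n, Metric.ediam (T n) ≤ 1) ∧
      ∑' n, ⨆ _ : (T n).Nonempty, Metric.ediam (T n) ^ τ < ε := by
  rw [hausdorffMeasure_apply] at h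
  have hlt : (⨅ (T : ℕ → Set X) (_ : E ⊆ ⋃ n, T n) (_ : ∀ n, Metric.ediam (T n) ≤ 1),
      ∑' n, ⨆ _ : (T n).Nonempty, Metric.ediam (T n) ^ τ) < ε := by
    refine lt_of_le_of_lt ?_ hε
    rw [← h]
    exact le_iSup₂_of_le (1 : ℝ≥0∞) one_pos le_rfl
  simpa only [iInf_lt_iff, exists_prop] using hlt

/- Replacing the diameters by slightly larger positive numbers avoids sets of diameter zero. -/
theorem exists_cover_of_hausdorffMeasure_eq_zero (hτ : 0 < τ) (h : μH[τ] E = 0) {ε : ℝ≥0∞}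
    (hε : 0 < ε) :
    ∃ (U : ℕ → Set X) (r : ℕ → ℝ), E ⊆ ⋃ n, U n ∧ (∀ n, 0 < r n) ∧
      (∀ n, ∀ u ∈ U n, ∀ v ∈ U n, dist u v ≤ r n) ∧
      ∑' n, ENNReal.ofReal (r n ^ τ) ≤ ε := by
  have hε2 : 0 < ε / 2 := ENNReal.half_pos hε.ne'
  obtain ⟨T, hT, hT1, hTsum⟩ := exists_cover_ediam_of_hausdorffMeasure_eq_zero h hε2
  obtain ⟨δ, hδ, hδsum⟩ := ENNReal.exists_pos_sum_of_countable hε2.ne' ℕ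
  have hTfin : ∀ n, Metric.ediam (T n) ≠ ∞ := fun n =>
    ne_top_of_le_ne_top ENNReal.one_ne_top (hT1 n)
  let v : ℕ → ℝ := fun n => (Metric.ediam (T n)).toReal ^ τ + δ n
  have hv : ∀ n, 0 < v n := fun n =>
    add_pos_of_nonneg_of_pos (by positivity) (by exact_mod_cast hδ n)
  refine ⟨T, fun n => v n ^ τ⁻¹, hT, fun n => Real.rpow_pos_of_pos (hv n) _, ?_, ?_⟩
  · intro n a ha b hb
    have hdist : dist a b ≤ (Metric.ediam (T n)).toReal := by
      rw [dist_edist]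
      exact ENNReal.toReal_mono (hTfin n) (Metric.edist_le_ediam_of_mem ha hb)
    rw [Real.le_rpow_inv_iff_of_pos dist_nonneg (hv n).le hτ]
    exact (Real.rpow_le_rpow dist_nonneg hdist hτ.le).trans
      (le_add_of_nonneg_right (δ n).coe_nonneg)
  · have hterm : ∀ n, ENNReal.ofReal ((v n ^ τ⁻¹) ^ τ) ≤
        (⨆ _ : (T n).Nonempty, Metric.ediam (T n) ^ τ) + δ n := by
      intro n
      rw [Real.rpow_inv_rpow (hv n).le hτ.ne', ENNReal.ofReal_add (by positivity) (by positivity),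
        ENNReal.ofReal_coe_nnreal, ← ENNReal.ofReal_rpow_of_nonneg (by positivity) hτ.le,
        ENNReal.ofReal_toReal (hTfin n)]
      gcongr
      rcases (T n).eq_empty_or_nonempty with hempty | hne
      · simp [hempty, hτ]
      · exact le_iSup_of_le hne le_rfl
    refine (ENNReal.tsum_le_tsum hterm).trans ?_
    rw [ENNReal.tsum_add, ← ENNReal.add_halves ε]
    exact add_le_add hTsum.le hδsum.le

theorem hausdorffMeasure_ne_zero_of_hasChildren [CompleteSpace X] {ρ : ℕ → ℝ}
    {F : ℕ → Set X} (hC : 1 ≤ C) (hτ : 0 < τ) (hτt : τ ≤ t)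
    (hρ : ∀ i, 0 < ρ i) (hρ0 : Tendsto ρ atTop (𝓝 0))
    (hsmall : ∀ i, C * (ρ (i + 1) / ρ i) ^ (t - τ) ≤ 1)
    (hchild : ∀ i c, HasChildren ι C t (ρ i) (ρ (i + 1)) (F i) c) (x₀ : X) :
    μH[τ] (Metric.closedBall x₀ (ρ 0) ∩ ⋂ i, F i) ≠ 0 := by
  intro hzero
  have hρτ : 0 < ρ 0 ^ τ := Real.rpow_pos_of_pos (hρ 0) _
  have hK : 0 < C / ρ 0 ^ τ := by positivity
  obtain ⟨U, r, hcov, hr, hU, hsum⟩ := exists_cover_of_hausdorffMeasure_eq_zero hτ hzero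
    (ENNReal.ofReal_pos.2 (show 0 < (2 * (C / ρ 0 ^ τ))⁻¹ by positivity))
  have hterm : ∀ n, ENNReal.ofReal (weight C τ (ρ 0) (r n)) ≤
      ENNReal.ofReal (C / ρ 0 ^ τ) * ENNReal.ofReal (r n ^ τ) := by
    intro n
    rw [← ENNReal.ofReal_mul hK.le]
    refine ENNReal.ofReal_le_ofReal ((min_le_right _ _).trans_eq ?_)
    rw [Real.div_rpow (hr n).le (hρ 0).le]
    ring
  refine absurd (one_le_tsum_weight hC hτ hτt hρ hρ0 hsmall hchild x₀ hr hU hcov) (not_le.2 ?_)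
  calc ∑' n, ENNReal.ofReal (weight C τ (ρ 0) (r n))
      ≤ ∑' n, ENNReal.ofReal (C / ρ 0 ^ τ) * ENNReal.ofReal (r n ^ τ) :=
        ENNReal.tsum_le_tsum hterm
    _ ≤ ENNReal.ofReal (C / ρ 0 ^ τ) * ENNReal.ofReal (2 * (C / ρ 0 ^ τ))⁻¹ := by
        rw [ENNReal.tsum_mul_left]
        gcongr
    _ = ENNReal.ofReal (1 / 2) := by
        rw [← ENNReal.ofReal_mul hK.le]
        congr 1
        field_simp
    _ < 1 := by
        rw [← ENNReal.ofReal_one]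
        exact (ENNReal.ofReal_lt_ofReal_iff one_pos).2 (by norm_num)

end HausdorffMeasure

section Denominators

theorem eventually_rpow_le_primeCounting {θ : ℝ} (hθ : θ < 1) :
    ∀ᶠ x : ℝ in atTop, 2 * x ^ θ ≤ Nat.primeCounting ⌊x⌋₊ := by
  have hc : (0 : ℝ) < 1 / 16 := by norm_num
  filter_upwards [(isLittleO_log_rpow_atTop (sub_pos.2 hθ)).bound hc,
    Real.isLittleO_log_id_atTop.bound hc, eventually_ge_atTop 4] with x hlog_rpow hlog_id hx
  have hx0 : 0 < x := by linarith
  have hlog : 0 < Real.log x := Real.log_pos (by linarith)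
  rw [Real.norm_of_nonneg hlog.le, Real.norm_of_nonneg (by positivity)] at hlog_rpow
  rw [Real.norm_of_nonneg hlog.le, id, Real.norm_of_nonneg hx0.le] at hlog_id
  refine le_trans ?_ (Chebyshev.pi_ge' (by linarith))
  rw [le_div_iff₀ hlog]
  have hlog_add_two : Real.log (x + 2) ≤ 2 * Real.log x := by
    rw [← Real.log_rpow hx0, Real.rpow_two]
    exact Real.log_le_log (by linarith) (by nlinarith)
  have hmain : x ^ θ * Real.log x ≤ x / 16 := by
    calc x ^ θ * Real.log x ≤ x ^ θ * (1 / 16 * x ^ (1 - θ)) := by gcongr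
      _ = x ^ θ * x ^ (1 - θ) / 16 := by ring
      _ = x / 16 := by rw [← Real.rpow_add hx0, add_sub_cancel, Real.rpow_one]
  nlinarith [Real.log_two_gt_d9]

/-- The denominators used in the construction: they are pairwise coprime, lie between `q ^ γ'` and
`q ^ γ`, and there are at least `q ^ γ'` of them. -/
structure IsDenominatorSet (γ γ' q : ℝ) (𝓗 : Finset ℕ) : Prop where
  one_or_prime : ∀ H ∈ 𝓗, H = 1 ∨ H.Prime
  le_rpow : ∀ H ∈ 𝓗, (H : ℝ) ≤ q ^ γ
  rpow_le : ∀ H ∈ 𝓗, q ^ γ' ≤ H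
  rpow_le_card : q ^ γ' ≤ 𝓗.card

variable {γ γ' q : ℝ} {𝓗 : Finset ℕ}

theorem pos_of_eq_one_or_prime {H : ℕ} (hH : H = 1 ∨ H.Prime) : 0 < H := by
  rcases hH with rfl | hH
  exacts [one_pos, hH.pos]

theorem IsDenominatorSet.pos (h : IsDenominatorSet γ γ' q 𝓗) {H : ℕ} (hH : H ∈ 𝓗) : 0 < H :=
  pos_of_eq_one_or_prime (h.one_or_prime H hH)

theorem IsDenominatorSet.isCoprime (h : IsDenominatorSet γ γ' q 𝓗) {H H' : ℕ} (hH : H ∈ 𝓗)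
    (hH' : H' ∈ 𝓗) (hne : H ≠ H') : IsCoprime (H : ℤ) (H' : ℤ) := by
  rw [Nat.isCoprime_iff_coprime]
  rcases h.one_or_prime H hH with rfl | hp
  · exact Nat.coprime_one_left _
  · rcases h.one_or_prime H' hH' with rfl | hp'
    · exact Nat.coprime_one_right _
    · exact (Nat.coprime_primes hp hp').2 hne

theorem isDenominatorSet_singleton_one (q : ℝ) : IsDenominatorSet 0 0 q {1} := by
  constructor <;> simp

theorem eventually_exists_isDenominatorSet (hγ' : 0 < γ') (h : γ' < γ) :
    ∀ᶠ q : ℝ in atTop, ∃ 𝓗, IsDenominatorSet γ γ' q 𝓗 := by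
  have hγ : 0 < γ := hγ'.trans h
  filter_upwards [(tendsto_rpow_atTop hγ).eventually
    (eventually_rpow_le_primeCounting ((div_lt_one hγ).2 h)), eventually_gt_atTop 0] with q hq hq0
  rw [← Real.rpow_mul hq0.le, mul_div_cancel₀ _ hγ.ne'] at hq
  let large : Finset ℕ := (Nat.primesLE ⌊q ^ γ⌋₊).filter fun p => q ^ γ' ≤ p
  let small : Finset ℕ := (Nat.primesLE ⌊q ^ γ⌋₊).filter fun p => ¬ q ^ γ' ≤ p
  have hprime : ∀ H ∈ large, H ≤ ⌊q ^ γ⌋₊ ∧ H.Prime := fun H hH =>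
    Nat.mem_primesLE.1 (Finset.mem_filter.1 hH).1
  refine ⟨large, fun H hH => Or.inr (hprime H hH).2,
    fun H hH => (Nat.le_floor_iff (by positivity)).1 (hprime H hH).1,
    fun H hH => (Finset.mem_filter.1 hH).2, ?_⟩
  have hsmall : small ⊆ Finset.Icc 1 ⌊q ^ γ'⌋₊ := by
    intro p hp
    obtain ⟨hprime, hlt⟩ := Finset.mem_filter.1 hp
    exact Finset.mem_Icc.2 ⟨(Nat.mem_primesLE.1 hprime).2.one_le, Nat.le_floor (not_le.1 hlt).le⟩
  have hcard_small : (small.card : ℝ) ≤ q ^ γ' := by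
    refine le_trans ?_ (Nat.floor_le (a := q ^ γ') (by positivity))
    have := Finset.card_le_card hsmall
    rw [Nat.card_Icc, Nat.add_sub_cancel] at this
    exact_mod_cast this
  have hcard : (Nat.primeCounting ⌊q ^ γ⌋₊ : ℝ) = large.card + small.card := by
    rw [← Nat.primesLE_card_eq_primeCounting]
    exact_mod_cast (Finset.card_filter_add_card_filter_not _).symm
  linarith

end Denominators

section ClosePairs

theorem card_le_of_separated {α : Type*} (S : Finset α) (f : α → ℝ) {a b δ : ℝ} (hδ : 0 < δ)
    (hab : a ≤ b) (hf : ∀ x ∈ S, f x ∈ Icc a b)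
    (hsep : ∀ x ∈ S, ∀ y ∈ S, x ≠ y → δ ≤ |f x - f y|) : (S.card : ℝ) ≤ (b - a) / δ + 1 := by
  have hfloor : 0 ≤ ⌊(b - a) / δ⌋ := Int.floor_nonneg.2 (div_nonneg (by linarith) hδ.le)
  have hcard : S.card ≤ (Finset.Icc 0 ⌊(b - a) / δ⌋).card := by
    refine Finset.card_le_card_of_injOn (fun x => ⌊(f x - a) / δ⌋) ?_ ?_
    · intro x hx
      obtain ⟨hax, hxb⟩ := hf x hx
      refine Finset.mem_coe.2 (Finset.mem_Icc.2
        ⟨Int.floor_nonneg.2 (div_nonneg (by linarith) hδ.le), Int.floor_le_floor ?_⟩)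
      gcongr
    · intro x hx y hy hxy
      by_contra hne
      have hlt := Int.abs_sub_lt_one_of_floor_eq_floor hxy
      rw [← sub_div, abs_div, abs_of_pos hδ, div_lt_one hδ, sub_sub_sub_cancel_right] at hlt
      exact (hsep x hx y hy hne).not_gt hlt
  have hcard_Icc : ((Finset.Icc 0 ⌊(b - a) / δ⌋).card : ℝ) = ⌊(b - a) / δ⌋ + 1 := by
    have := Int.card_Icc_of_le 0 ⌊(b - a) / δ⌋ (by omega)
    rw [sub_zero] at this
    exact_mod_cast this
  calc (S.card : ℝ) ≤ (Finset.Icc 0 ⌊(b - a) / δ⌋).card := by exact_mod_cast hcard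
    _ = ⌊(b - a) / δ⌋ + 1 := hcard_Icc
    _ ≤ (b - a) / δ + 1 := by gcongr; exact Int.floor_le _

theorem card_int_near_le {D x r : ℝ} (hD : 0 < D) (hr : 0 ≤ r) (S : Finset ℤ)
    (hS : ∀ p ∈ S, |(p : ℝ) / D - x| ≤ r) : (S.card : ℝ) ≤ 2 * r * D + 1 := by
  refine (card_le_of_separated S (fun p : ℤ => (p : ℝ) / D) (a := x - r) (b := x + r)
    (δ := 1 / D) (by positivity) (by linarith) (fun p hp => ?_) fun p _ p' _ hne => ?_).trans_eq ?_
  · obtain ⟨hlow, hupp⟩ := abs_le.1 (hS p hp)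
    exact ⟨by linarith, by linarith⟩
  · rw [← sub_div, abs_div, abs_of_pos hD]
    gcongr
    exact_mod_cast Int.one_le_abs (sub_ne_zero.2 hne)
  · field_simp
    ring

open Classical in
/-- The numerators `p` coprime to `H` for which `p / (H w)` is within `ℓ / 2` of `c`. -/
noncomputable def numerators (w c ℓ : ℝ) (H : ℕ) : Finset ℤ :=
  (Finset.Icc ⌈(H * w) * (c - ℓ / 2)⌉ ⌊(H * w) * (c + ℓ / 2)⌋).filter fun p => IsCoprime p (H : ℤ)

variable {w c ℓ r : ℝ} {H H' : ℕ}

theorem mem_numerators (hw : 0 < w) (hH : 0 < H) {p : ℤ} :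
    p ∈ numerators w c ℓ H ↔ |(p : ℝ) / (H * w) - c| ≤ ℓ / 2 ∧ IsCoprime p (H : ℤ) := by
  have hD : 0 < (H : ℝ) * w := by positivity
  rw [numerators, Finset.mem_filter, Finset.mem_Icc, Int.ceil_le, Int.le_floor,
    ← le_div_iff₀' hD, ← div_le_iff₀' hD, ← mem_Icc, ← Real.closedBall_eq_Icc,
    Metric.mem_closedBall, Real.dist_eq]

theorem card_numerators_le (hw : 0 < w) (hH : 0 < H) (hℓ : 0 ≤ ℓ) :
    ((numerators w c ℓ H).card : ℝ) ≤ H * w * ℓ + 1 :=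
  (card_int_near_le (D := H * w) (by positivity) (div_nonneg hℓ zero_le_two) _
    fun p hp => ((mem_numerators hw hH).1 hp).1).trans_eq (by ring)

theorem isCoprime_or_isCoprime_add_one (hH : H = 1 ∨ H.Prime) (k : ℤ) :
    IsCoprime k (H : ℤ) ∨ IsCoprime (k + 1) (H : ℤ) := by
  rcases hH with rfl | hH
  · exact Or.inl (by simp [isCoprime_one_right])
  · have hp : Prime (H : ℤ) := Nat.prime_iff_prime_int.1 hH
    by_contra! hnot
    simp only [isCoprime_comm (y := (H : ℤ)), hp.irreducible.coprime_iff_not_dvd,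
      not_not] at hnot
    have hone : (H : ℤ) ∣ 1 := by simpa only [add_sub_cancel_left] using dvd_sub hnot.2 hnot.1
    exact hp.not_isUnit (isUnit_of_dvd_one hone)

/- One of `2k`, `2k + 1` is coprime to `H`, so at least about half of the integers are. -/
theorem le_card_numerators (hH : H = 1 ∨ H.Prime) (hℓ : 6 ≤ H * w * ℓ) :
    (H : ℝ) * w * ℓ / 4 ≤ (numerators w c ℓ H).card := by
  classical
  let a := ⌈(H : ℝ) * w * (c - ℓ / 2) / 2⌉
  let b := ⌊((H : ℝ) * w * (c + ℓ / 2) - 1) / 2⌋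
  have hcard : (Finset.Icc a b).card ≤ (numerators w c ℓ H).card := by
    refine Finset.card_le_card_of_injOn
      (fun k => if IsCoprime (2 * k) (H : ℤ) then 2 * k else 2 * k + 1) ?_ ?_
    · intro k hk
      obtain ⟨hak, hkb⟩ := Finset.mem_Icc.1 (Finset.mem_coe.1 hk)
      rw [Int.ceil_le] at hak
      rw [Int.le_floor] at hkb
      rw [Finset.mem_coe, numerators, Finset.mem_filter, Finset.mem_Icc, Int.ceil_le, Int.le_floor]
      dsimp only
      split_ifs with hc
      · refine ⟨⟨?_, ?_⟩, hc⟩ <;> push_cast <;> linarith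
      · refine ⟨⟨?_, ?_⟩, (isCoprime_or_isCoprime_add_one hH _).resolve_left hc⟩ <;>
          push_cast <;> linarith
    · intro k _ k' _ hkk
      dsimp only at hkk
      split_ifs at hkk <;> omega
  have ha : (a : ℝ) < (H : ℝ) * w * (c - ℓ / 2) / 2 + 1 := Int.ceil_lt_add_one _
  have hb : ((H : ℝ) * w * (c + ℓ / 2) - 1) / 2 - 1 < b := Int.sub_one_lt_floor _
  calc (H : ℝ) * w * ℓ / 4 ≤ b + 1 - a := by linarith
    _ ≤ (Finset.Icc a b).card := by
        rw [Int.card_Icc]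
        exact_mod_cast Int.self_le_toNat (b + 1 - a)
    _ ≤ (numerators w c ℓ H).card := by exact_mod_cast hcard

open Classical in
/-- The pairs of numerators for the denominators `H` and `H'` whose fractions are `r`-close. -/
noncomputable def closePairs (w c ℓ r : ℝ) (H H' : ℕ) : Finset (ℤ × ℤ) :=
  (numerators w c ℓ H ×ˢ numerators w c ℓ H').filter fun p =>
    |(p.1 : ℝ) / (H * w) - p.2 / (H' * w)| ≤ r

theorem mem_closePairs {p : ℤ × ℤ} : p ∈ closePairs w c ℓ r H H' ↔
    (p.1 ∈ numerators w c ℓ H ∧ p.2 ∈ numerators w c ℓ H') ∧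
      |(p.1 : ℝ) / (H * w) - p.2 / (H' * w)| ≤ r := by
  rw [closePairs, Finset.mem_filter, Finset.mem_product]

theorem card_closePairs_le (hw : 0 < w) (hH : 0 < H) (hH' : 0 < H') (hℓ : 0 ≤ ℓ) (hr : 0 ≤ r) :
    ((closePairs w c ℓ r H H').card : ℝ) ≤ (H * w * ℓ + 1) * (2 * r * (H' * w) + 1) := by
  classical
  have hsum : (closePairs w c ℓ r H H').card = ∑ p ∈ numerators w c ℓ H,
      ((numerators w c ℓ H').filter fun p' : ℤ =>
        |(p : ℝ) / (H * w) - p' / (H' * w)| ≤ r).card := by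
    simp only [closePairs, Finset.card_filter, Finset.sum_product]
  rw [hsum]
  push_cast
  refine (Finset.sum_le_card_nsmul _ _ (2 * r * (H' * w) + 1) fun p _ => ?_).trans ?_
  · refine card_int_near_le (x := (p : ℝ) / (H * w)) (by positivity) hr _ fun p' hp' => ?_
    rw [abs_sub_comm]
    exact (Finset.mem_filter.1 hp').2
  · rw [nsmul_eq_mul]
    gcongr
    exact card_numerators_le hw hH hℓ

theorem mul_sub_mul_ne_zero {p p' : ℤ} (hp : IsCoprime p (H : ℤ)) (hp' : IsCoprime p' (H' : ℤ))
    (hne : H ≠ H') : p * H' - p' * H ≠ 0 := by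
  refine fun hzero => hne ?_
  have heq : p * H' = p' * H := sub_eq_zero.1 hzero
  have hdvd : (H : ℤ) ∣ H' := hp.symm.dvd_of_dvd_mul_left (heq ▸ Dvd.intro_left _ rfl)
  have hdvd' : (H' : ℤ) ∣ H := hp'.symm.dvd_of_dvd_mul_left (heq ▸ Dvd.intro_left _ rfl)
  exact Nat.dvd_antisymm (Int.natCast_dvd_natCast.1 hdvd) (Int.natCast_dvd_natCast.1 hdvd')

theorem abs_mul_sub_mul_le {p p' : ℤ} (hw : 0 < w) (hH : 0 < H) (hH' : 0 < H')
    (h : |(p : ℝ) / (H * w) - p' / (H' * w)| ≤ r) :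
    |((p * H' - p' * H : ℤ) : ℝ)| ≤ r * H * H' * w := by
  have hdet : ((p * H' - p' * H : ℤ) : ℝ) =
      ((p : ℝ) / (H * w) - p' / (H' * w)) * (H * H' * w) := by
    push_cast
    field_simp
  rw [hdet, abs_mul, abs_of_pos (show (0 : ℝ) < H * H' * w by positivity)]
  calc _ ≤ r * (H * H' * w) := by gcongr
    _ = r * H * H' * w := by ring

theorem card_nonzero_int_le {M : ℝ} (hM : 0 ≤ M) :
    (((Finset.Icc (-⌊M⌋) ⌊M⌋).erase 0).card : ℝ) ≤ 2 * M := by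
  have hzero : (0 : ℤ) ∈ Finset.Icc (-⌊M⌋) ⌊M⌋ := mem_Icc_floor_iff.2 (by simpa using hM)
  have hcard : (((Finset.Icc (-⌊M⌋) ⌊M⌋).erase 0).card : ℝ) + 1 =
      (Finset.Icc (-⌊M⌋) ⌊M⌋).card := by exact_mod_cast Finset.card_erase_add_one hzero
  linarith [card_Icc_floor_le hM]

theorem natCast_le_abs_sub_of_mul_sub_mul_eq (hH : 0 < H) (hcop : IsCoprime (H : ℤ) (H' : ℤ))
    {p p' : ℤ × ℤ} (heq : p.1 * H' - p.2 * H = p'.1 * H' - p'.2 * H) (hne : p ≠ p') :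
    (H : ℤ) ≤ |p.1 - p'.1| := by
  have hmul : (p.1 - p'.1) * H' = (p.2 - p'.2) * H := by linarith
  have hdvd : (H : ℤ) ∣ p.1 - p'.1 := hcop.dvd_of_dvd_mul_right (hmul ▸ Dvd.intro_left _ rfl)
  refine Int.le_of_dvd (abs_pos.2 fun hzero => hne ?_) ((dvd_abs _ _).2 hdvd)
  rw [hzero, zero_mul, eq_comm, mul_eq_zero] at hmul
  have hsnd := hmul.resolve_right (by exact_mod_cast hH.ne')
  exact Prod.ext (by linarith) (by linarith)

theorem card_le_of_mul_sub_mul_eq (hw : 0 < w) (hH : 0 < H) (hcop : IsCoprime (H : ℤ) (H' : ℤ))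
    (hℓ : 0 ≤ ℓ) {m : ℤ} (S : Finset (ℤ × ℤ)) (hnear : ∀ p ∈ S, |(p.1 : ℝ) / (H * w) - c| ≤ ℓ / 2)
    (hdet : ∀ p ∈ S, p.1 * H' - p.2 * H = m) : (S.card : ℝ) ≤ w * ℓ + 1 := by
  refine (card_le_of_separated S (fun p : ℤ × ℤ => (p.1 : ℝ) / (H * w))
    (a := c - ℓ / 2) (b := c + ℓ / 2) (δ := 1 / w) (by positivity) (by linarith)
    (fun p hp => ?_) fun p hp p' hp' hne => ?_).trans_eq ?_
  · obtain ⟨hlow, hupp⟩ := abs_le.1 (hnear p hp)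
    exact ⟨by linarith, by linarith⟩
  · have hsep : (H : ℝ) ≤ |(p.1 : ℝ) - p'.1| := by
      exact_mod_cast natCast_le_abs_sub_of_mul_sub_mul_eq hH hcop
        ((hdet p hp).trans (hdet p' hp').symm) hne
    rw [← sub_div, abs_div, abs_of_pos (show 0 < (H : ℝ) * w by positivity),
      div_le_div_iff₀ hw (by positivity), one_mul]
    gcongr
  · field_simp
    ring

/- Close fractions `p / (H w)` and `p' / (H' w)` have a small determinant `p H' - p' H`, which is
nonzero because both are reduced, and each value of it is taken by at most `w ℓ + 1` pairs. -/
theorem card_closePairs_le_of_coprime (hw : 0 < w) (hH : 0 < H) (hH' : 0 < H') (hne : H ≠ H')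
    (hcop : IsCoprime (H : ℤ) (H' : ℤ)) (hℓ : 0 ≤ ℓ) (hr : 0 ≤ r) :
    ((closePairs w c ℓ r H H').card : ℝ) ≤ 2 * (r * H * H' * w) * (w * ℓ + 1) := by
  classical
  have hmaps : Set.MapsTo (fun p : ℤ × ℤ => p.1 * H' - p.2 * H) (closePairs w c ℓ r H H')
      ((Finset.Icc (-⌊r * H * H' * w⌋) ⌊r * H * H' * w⌋).erase 0) := by
    rintro ⟨p, p'⟩ hp
    obtain ⟨⟨hnum, hnum'⟩, hclose⟩ := mem_closePairs.1 (Finset.mem_coe.1 hp)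
    exact Finset.mem_coe.2 (Finset.mem_erase.2
      ⟨mul_sub_mul_ne_zero ((mem_numerators hw hH).1 hnum).2 ((mem_numerators hw hH').1 hnum').2
        hne,
        mem_Icc_floor_iff.2 (abs_mul_sub_mul_le hw hH hH' hclose)⟩)
  rw [Finset.card_eq_sum_card_fiberwise hmaps]
  push_cast
  refine (Finset.sum_le_card_nsmul _ _ (w * ℓ + 1) fun m _ => ?_).trans ?_
  · refine card_le_of_mul_sub_mul_eq (c := c) (m := m) hw hH hcop hℓ _ (fun p hp => ?_)
      fun p hp => (Finset.mem_filter.1 hp).2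
    exact ((mem_numerators hw hH).1 (mem_closePairs.1 (Finset.mem_filter.1 hp).1).1.1).1
  · rw [nsmul_eq_mul]
    gcongr
    exact card_nonzero_int_le (by positivity)

end ClosePairs

section Counting

variable {d : ℕ} {w c a : Fin d → ℝ} {ℓ r q : ℝ} {𝓗 : Finset ℕ} {H H' : ℕ}

/-- The pairs of a denominator in `𝓗` and a vector of numerators whose fraction, see `fracPoint`,
lies in the cube of side `ℓ` about `c` and is reduced in every coordinate. -/
noncomputable def fractions (w c : Fin d → ℝ) (ℓ : ℝ) (𝓗 : Finset ℕ) :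
    Finset (Σ _ : ℕ, Fin d → ℤ) :=
  𝓗.sigma fun H => Fintype.piFinset fun j => numerators (w j) (c j) ℓ H

open Classical in
theorem sum_card_close_le_sum_prod_closePairs (w c : Fin d → ℝ) (ℓ : ℝ) (𝓗 : Finset ℕ)
    (hr : 0 ≤ r) :
    ∑ a ∈ fractions w c ℓ 𝓗, ((fractions w c ℓ 𝓗).filter fun b =>
        dist (fracPoint w a.1 a.2) (fracPoint w b.1 b.2) ≤ r).card ≤
      ∑ H ∈ 𝓗, ∑ H' ∈ 𝓗, ∏ j, (closePairs (w j) (c j) ℓ r H H').card := by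
  simp only [fractions, Finset.card_filter, Finset.sum_sigma]
  refine Finset.sum_le_sum fun H _ => ?_
  rw [Finset.sum_comm]
  refine Finset.sum_le_sum fun H' _ => ?_
  rw [← Finset.sum_product', ← Finset.card_filter, ← Fintype.card_piFinset]
  refine Finset.card_le_card_of_injOn (fun p j => (p.1 j, p.2 j)) ?_ ?_
  · rintro ⟨p, p'⟩ hp
    obtain ⟨hmem, hdist⟩ := Finset.mem_filter.1 (Finset.mem_coe.1 hp)
    rw [Finset.mem_product, Fintype.mem_piFinset, Fintype.mem_piFinset] at hmem
    rw [dist_pi_le_iff hr] at hdist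
    exact Finset.mem_coe.2 (Fintype.mem_piFinset.2 fun j =>
      mem_closePairs.2 ⟨⟨hmem.1 j, hmem.2 j⟩, (Real.dist_eq _ _).symm.trans_le (hdist j)⟩)
  · rintro ⟨p, p'⟩ _ ⟨u, u'⟩ _ h
    simp only [funext_iff, Prod.mk.injEq] at h ⊢
    exact ⟨fun j => (h j).1, fun j => (h j).2⟩

/-- The volume heuristic for the number of vectors of numerators for the denominator `H` in a cube
of side `ℓ`. -/
noncomputable def mass (w : Fin d → ℝ) (ℓ : ℝ) (H : ℕ) : ℝ := ∏ j, (H * w j * ℓ)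

theorem mass_nonneg (hw : ∀ j, 0 < w j) (hℓ : 0 ≤ ℓ) (H : ℕ) : 0 ≤ mass w ℓ H :=
  Finset.prod_nonneg fun j _ => mul_nonneg (mul_nonneg H.cast_nonneg (hw j).le) hℓ

theorem sum_mass_le_card (hw : ∀ j, 0 < w j) (h𝓗 : ∀ H ∈ 𝓗, H = 1 ∨ H.Prime) (hℓ : 0 ≤ ℓ)
    (hlarge : ∀ H ∈ 𝓗, ∀ j, 6 ≤ H * w j * ℓ) :
    ∑ H ∈ 𝓗, mass w ℓ H ≤ 4 ^ d * (fractions w c ℓ 𝓗).card := by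
  rw [fractions, Finset.card_sigma, Nat.cast_sum, Finset.mul_sum]
  refine Finset.sum_le_sum fun H hH => ?_
  rw [Fintype.card_piFinset, Nat.cast_prod, mass, ← Fin.prod_const d (4 : ℝ),
    ← Finset.prod_mul_distrib]
  refine Finset.prod_le_prod (fun j _ => mul_nonneg (mul_nonneg H.cast_nonneg (hw j).le) hℓ)
    fun j _ => ?_
  linarith [le_card_numerators (c := c j) (h𝓗 H hH) (hlarge H hH j)]

theorem prod_card_closePairs_le_of_one_le_mul (hw : ∀ j, 0 < w j) (hH : 0 < H) (hH' : 0 < H')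
    (hℓ : 0 < ℓ) (hr : 0 ≤ r) (hHℓ : ∀ j, 1 ≤ H * w j * ℓ) (hHr : ∀ j, 1 ≤ r * (H' * w j)) :
    ∏ j, ((closePairs (w j) (c j) ℓ r H H').card : ℝ) ≤
      6 ^ d * (r / ℓ) ^ d * (mass w ℓ H * mass w ℓ H') := by
  rw [mass, mass, ← mul_pow, ← Fin.prod_const, ← Finset.prod_mul_distrib,
    ← Finset.prod_mul_distrib]
  refine Finset.prod_le_prod (fun j _ => Nat.cast_nonneg _) fun j _ => ?_
  calc ((closePairs (w j) (c j) ℓ r H H').card : ℝ)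
      ≤ (H * w j * ℓ + 1) * (2 * r * (H' * w j) + 1) := card_closePairs_le (hw j) hH hH' hℓ.le hr
    _ ≤ (2 * (H * w j * ℓ)) * (3 * (r * (H' * w j))) := by
        have := hHℓ j
        have := hHr j
        gcongr <;> linarith
    _ = 6 * (r / ℓ) * (H * w j * ℓ * (H' * w j * ℓ)) := by field_simp; ring

theorem prod_card_closePairs_le_of_coprime (hw : ∀ j, 1 ≤ w j) (hH : 0 < H) (hH' : 0 < H')
    (hne : H ≠ H') (hcop : IsCoprime (H : ℤ) (H' : ℤ)) (hℓ0 : 0 < ℓ) (hℓ1 : ℓ ≤ 1)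
    (hr : 0 ≤ r) :
    ∏ j, ((closePairs (w j) (c j) ℓ r H H').card : ℝ) ≤
      4 ^ d * ((r / ℓ) ^ d * (ℓ ^ d)⁻¹) * (mass w ℓ H * mass w ℓ H') := by
  rw [mass, mass, ← inv_pow, ← mul_pow, ← mul_pow, ← Fin.prod_const, ← Finset.prod_mul_distrib,
    ← Finset.prod_mul_distrib]
  refine Finset.prod_le_prod (fun j _ => Nat.cast_nonneg _) fun j _ => ?_
  have hwj : 0 < w j := zero_lt_one.trans_le (hw j)
  calc ((closePairs (w j) (c j) ℓ r H H').card : ℝ)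
      ≤ 2 * (r * H * H' * w j) * (w j * ℓ + 1) :=
        card_closePairs_le_of_coprime hwj hH hH' hne hcop hℓ0.le hr
    _ ≤ 2 * (r * H * H' * w j) * (2 * w j) := by
        gcongr
        nlinarith [hw j]
    _ = 4 * (r / ℓ * ℓ⁻¹) * (H * w j * ℓ * (H' * w j * ℓ)) := by field_simp; ring

theorem prod_card_closePairs_self_le (hw : ∀ j, 0 < w j) (hH : 0 < H) (hℓ : 0 < ℓ)
    (hr0 : 0 < r) (hr1 : r ≤ 1) (hrq : 1 ≤ r * q) (hHℓ : ∀ j, 1 ≤ H * w j * ℓ)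
    (ha0 : ∀ j, 0 ≤ a j) (ha1 : ∀ j, a j ≤ 1) (hHw : ∀ j, H * w j ≤ q ^ a j) :
    ∏ j, ((closePairs (w j) (c j) ℓ r H H).card : ℝ) ≤
      6 ^ d * (r * q) ^ (∑ j, a j) * mass w ℓ H := by
  have hq : 0 < q := pos_of_mul_pos_right (zero_lt_one.trans_le hrq) hr0.le
  rw [mass, Real.rpow_sum_of_pos (by positivity), ← Fin.prod_const, ← Finset.prod_mul_distrib,
    ← Finset.prod_mul_distrib]
  refine Finset.prod_le_prod (fun j _ => Nat.cast_nonneg _) fun j _ => ?_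
  have hone : 1 ≤ (r * q) ^ a j := Real.one_le_rpow hrq (ha0 j)
  have hwj := hw j
  have hspacing : r * (H * w j) ≤ (r * q) ^ a j := by
    rw [Real.mul_rpow hr0.le hq.le]
    exact mul_le_mul (Real.self_le_rpow_of_le_one hr0.le hr1 (ha1 j)) (hHw j) (by positivity)
      (by positivity)
  calc ((closePairs (w j) (c j) ℓ r H H).card : ℝ)
      ≤ (H * w j * ℓ + 1) * (2 * r * (H * w j) + 1) := card_closePairs_le hwj hH hH hℓ.le hr0.le
    _ ≤ (2 * (H * w j * ℓ)) * (3 * (r * q) ^ a j) := by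
        have := hHℓ j
        gcongr <;> linarith
    _ = 6 * (r * q) ^ a j * (H * w j * ℓ) := by ring

theorem IsDenominatorSet.rpow_le_sum_mass {γ γ' : ℝ} {β : Fin d → ℝ}
    (h : IsDenominatorSet γ γ' q 𝓗) (hq : 0 < q) (hℓ : 0 ≤ ℓ) :
    q ^ countExponent γ' β * ℓ ^ d ≤ ∑ H ∈ 𝓗, mass (fun j => q ^ β j) ℓ H := by
  have hmass : ∀ H ∈ 𝓗, (∏ j, q ^ (γ' + β j)) * ℓ ^ d ≤ mass (fun j => q ^ β j) ℓ H := by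
    intro H hH
    rw [mass, ← Fin.prod_const, ← Finset.prod_mul_distrib]
    refine Finset.prod_le_prod (fun j _ => by positivity) fun j _ => ?_
    rw [Real.rpow_add hq]
    have := h.rpow_le H hH
    gcongr
  calc q ^ countExponent γ' β * ℓ ^ d = q ^ γ' * ((∏ j, q ^ (γ' + β j)) * ℓ ^ d) := by
        rw [rpow_countExponent γ' β hq, mul_assoc]
    _ ≤ 𝓗.card * ((∏ j, q ^ (γ' + β j)) * ℓ ^ d) := by
        gcongr
        exact h.rpow_le_card
    _ ≤ ∑ H ∈ 𝓗, mass (fun j => q ^ β j) ℓ H := by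
        rw [← nsmul_eq_mul]
        exact Finset.card_nsmul_le_sum _ _ _ hmass

end Counting

section Energy

variable {d : ℕ} {β c w : Fin d → ℝ} {γ γ' t κ η q ℓ r G : ℝ} {𝓗 : Finset ℕ} {H : ℕ}

theorem sum_sum_mass_mul_mass (w : Fin d → ℝ) (ℓ : ℝ) (𝓗 : Finset ℕ) (A : ℝ) :
    ∑ H ∈ 𝓗, ∑ H' ∈ 𝓗, A * (mass w ℓ H * mass w ℓ H') = A * (∑ H ∈ 𝓗, mass w ℓ H) ^ 2 := by
  rw [sq, Finset.sum_mul_sum]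
  simp only [Finset.mul_sum]

theorem sum_prod_card_closePairs_le_of_one_le_mul (hw : ∀ j, 0 < w j) (h𝓗 : ∀ H ∈ 𝓗, 0 < H)
    (hr : 0 < r) (hrℓ : r ≤ ℓ) (ht : t ≤ d) (hHℓ : ∀ H ∈ 𝓗, ∀ j, 1 ≤ H * w j * ℓ)
    (hHr : ∀ H ∈ 𝓗, ∀ j, 1 ≤ r * (H * w j)) :
    ∑ H ∈ 𝓗, ∑ H' ∈ 𝓗, ∏ j, ((closePairs (w j) (c j) ℓ r H H').card : ℝ) ≤
      6 ^ d * (∑ H ∈ 𝓗, mass w ℓ H) ^ 2 * (r / ℓ) ^ t := by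
  have hℓ : 0 < ℓ := hr.trans_le hrℓ
  calc ∑ H ∈ 𝓗, ∑ H' ∈ 𝓗, ∏ j, ((closePairs (w j) (c j) ℓ r H H').card : ℝ)
      ≤ ∑ H ∈ 𝓗, ∑ H' ∈ 𝓗, 6 ^ d * (r / ℓ) ^ d * (mass w ℓ H * mass w ℓ H') :=
        Finset.sum_le_sum fun H hH => Finset.sum_le_sum fun H' hH' =>
          prod_card_closePairs_le_of_one_le_mul hw (h𝓗 H hH) (h𝓗 H' hH') hℓ hr.le (hHℓ H hH)
            (hHr H' hH')
    _ = 6 ^ d * (∑ H ∈ 𝓗, mass w ℓ H) ^ 2 * (r / ℓ) ^ (d : ℝ) := by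
        rw [sum_sum_mass_mul_mass, Real.rpow_natCast]
        ring
    _ ≤ 6 ^ d * (∑ H ∈ 𝓗, mass w ℓ H) ^ 2 * (r / ℓ) ^ t := by
        gcongr 6 ^ d * _ * ?_
        exact Real.rpow_le_rpow_of_exponent_ge (by positivity) ((div_le_one hℓ).2 hrℓ) ht

/- Pairs of fractions with the same denominator are the fewer ones, but they satisfy a weaker
bound, which has to be absorbed by the total mass. -/
theorem IsDenominatorSet.sum_prod_card_closePairs_le (h : IsDenominatorSet γ γ' q 𝓗)
    (hβ : ∀ j, 0 ≤ β j) (h0 : ∀ j, 0 ≤ γ + β j) (h1 : ∀ j, γ + β j ≤ 1) (hq : 1 ≤ q)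
    (hℓ0 : 0 < ℓ) (hℓ1 : ℓ ≤ 1) (hr0 : 0 < r) (hr1 : r ≤ 1) (hrq : 1 ≤ r * q)
    (hHℓ : ∀ H ∈ 𝓗, ∀ j, 1 ≤ H * q ^ β j * ℓ) (hG : (r / ℓ) ^ d * (ℓ ^ d)⁻¹ ≤ G)
    (hMG : (r * q) ^ (∑ j, (γ + β j)) ≤ (∑ H ∈ 𝓗, mass (fun j => q ^ β j) ℓ H) * G) :
    ∑ H ∈ 𝓗, ∑ H' ∈ 𝓗, ∏ j, ((closePairs (q ^ β j) (c j) ℓ r H H').card : ℝ) ≤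
      2 * 6 ^ d * (∑ H ∈ 𝓗, mass (fun j => q ^ β j) ℓ H) ^ 2 * G := by
  have hq0 : 0 < q := zero_lt_one.trans_le hq
  have hw : ∀ j, 1 ≤ q ^ β j := fun j => Real.one_le_rpow hq (hβ j)
  let m : ℕ → ℝ := mass (fun j => q ^ β j) ℓ
  have hm : ∀ H, 0 ≤ m H := mass_nonneg (fun j => by positivity) hℓ0.le
  have hG0 : 0 ≤ G := le_trans (by positivity) hG
  have hpair : ∀ H ∈ 𝓗, ∀ H' ∈ 𝓗, ∏ j, ((closePairs (q ^ β j) (c j) ℓ r H H').card : ℝ) ≤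
      6 ^ d * G * (m H * m H') + if H = H' then 6 ^ d * ((∑ H ∈ 𝓗, m H) * G) * m H else 0 := by
    intro H hH H' hH'
    have hmm : 0 ≤ m H * m H' := mul_nonneg (hm H) (hm H')
    split_ifs with heq
    · subst heq
      refine le_add_of_nonneg_of_le (by positivity) ((prod_card_closePairs_self_le
        (fun j => by positivity) (h.pos hH) hℓ0 hr0 hr1 hrq (hHℓ H hH) h0 h1
        fun j => ?_).trans ?_)
      · rw [Real.rpow_add hq0]
        exact mul_le_mul_of_nonneg_right (h.le_rpow H hH) (by positivity)
      · exact mul_le_mul_of_nonneg_right (mul_le_mul_of_nonneg_left hMG (by positivity)) (hm H)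
    · rw [add_zero]
      refine (prod_card_closePairs_le_of_coprime hw (h.pos hH) (h.pos hH') heq
        (h.isCoprime hH hH' heq) hℓ0 hℓ1 hr0.le).trans ?_
      exact mul_le_mul_of_nonneg_right (mul_le_mul (by gcongr; norm_num) hG (by positivity)
        (by positivity)) hmm
  calc ∑ H ∈ 𝓗, ∑ H' ∈ 𝓗, ∏ j, ((closePairs (q ^ β j) (c j) ℓ r H H').card : ℝ)
      ≤ ∑ H ∈ 𝓗, ∑ H' ∈ 𝓗, (6 ^ d * G * (m H * m H') +
          if H = H' then 6 ^ d * ((∑ H ∈ 𝓗, m H) * G) * m H else 0) :=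
        Finset.sum_le_sum fun H hH => Finset.sum_le_sum fun H' hH' => hpair H hH H' hH'
    _ = 6 ^ d * G * (∑ H ∈ 𝓗, m H) ^ 2 + 6 ^ d * ((∑ H ∈ 𝓗, m H) * G) * ∑ H ∈ 𝓗, m H := by
        simp only [Finset.sum_add_distrib, m, sum_sum_mass_mul_mass, Finset.sum_ite_eq,
          Finset.sum_ite_mem, Finset.inter_self, Finset.mul_sum]
    _ = 2 * 6 ^ d * (∑ H ∈ 𝓗, m H) ^ 2 * G := by ring

theorem div_pow_mul_inv_pow_le_div_rpow (hq1 : 1 ≤ q) (ht : t ≤ d)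
    (hexp : η * d ≤ (κ - η) * (d - t)) (hℓ : q ^ (-η) ≤ ℓ) (hr0 : 0 < r) (hr : r ≤ q ^ (-κ)) :
    (r / ℓ) ^ d * (ℓ ^ d)⁻¹ ≤ (r / ℓ) ^ t := by
  have hq : 0 < q := zero_lt_one.trans_le hq1
  have hℓ0 : 0 < ℓ := (Real.rpow_pos_of_pos hq _).trans_le hℓ
  have hratio : (r / ℓ) ^ ((d : ℝ) - t) ≤ q ^ ((η - κ) * (d - t)) := by
    rw [Real.rpow_mul hq.le]
    refine Real.rpow_le_rpow (by positivity) ?_ (by linarith)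
    calc r / ℓ ≤ q ^ (-κ) / q ^ (-η) := by gcongr
      _ = q ^ (η - κ) := by rw [← Real.rpow_sub hq]; ring_nf
  have hinv : (ℓ ^ d)⁻¹ ≤ q ^ (η * d) := by
    rw [Real.rpow_mul hq.le, Real.rpow_natCast, ← inv_pow]
    gcongr
    rwa [inv_le_comm₀ hℓ0 (by positivity), ← Real.rpow_neg hq.le]
  calc (r / ℓ) ^ d * (ℓ ^ d)⁻¹ = (r / ℓ) ^ t * ((r / ℓ) ^ ((d : ℝ) - t) * (ℓ ^ d)⁻¹) := by
        rw [← mul_assoc, ← Real.rpow_add (by positivity), add_sub_cancel, Real.rpow_natCast]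
    _ ≤ (r / ℓ) ^ t * (q ^ ((η - κ) * (d - t)) * q ^ (η * d)) := by gcongr
    _ ≤ (r / ℓ) ^ t * 1 := by
        gcongr
        rw [← Real.rpow_add hq]
        exact Real.rpow_le_one_of_one_le_of_nonpos hq1 (by linarith)
    _ = (r / ℓ) ^ t := mul_one _

theorem mul_rpow_le_rpow_mul_pow_mul_div_rpow {σ s : ℝ} (hq1 : 1 ≤ q) (ht : 0 ≤ t)
    (hexp : (1 - κ) * (σ - t) ≤ s - t - η * d) (hexp0 : 0 ≤ s - t - η * d)
    (hℓ : q ^ (-η) ≤ ℓ) (hℓ1 : ℓ ≤ 1) (hr0 : 0 < r) (hrq : 1 ≤ r * q) (hr : r ≤ q ^ (-κ)) :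
    (r * q) ^ σ ≤ q ^ s * ℓ ^ d * (r / ℓ) ^ t := by
  have hq : 0 < q := zero_lt_one.trans_le hq1
  have hℓ0 : 0 < ℓ := (Real.rpow_pos_of_pos hq _).trans_le hℓ
  have hexcess : (r * q) ^ (σ - t) ≤ q ^ (s - t - η * d) := by
    rcases le_total σ t with hσ | hσ
    · exact (Real.rpow_le_one_of_one_le_of_nonpos hrq (by linarith)).trans
        (Real.one_le_rpow hq1 hexp0)
    · refine le_trans ?_ (Real.rpow_le_rpow_of_exponent_le hq1 hexp)
      rw [Real.rpow_mul hq.le]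
      refine Real.rpow_le_rpow (by positivity) ?_ (by linarith)
      calc r * q ≤ q ^ (-κ) * q := by gcongr
        _ = q ^ (1 - κ) := by rw [← Real.rpow_add_one hq.ne']; ring_nf
  have hpow : q ^ (-(η * d)) ≤ ℓ ^ d := by
    rw [← neg_mul, Real.rpow_mul hq.le, Real.rpow_natCast]
    gcongr
  have hdiv : r ^ t ≤ (r / ℓ) ^ t := Real.rpow_le_rpow hr0.le (le_div_self hr0.le hℓ0 hℓ1) ht
  calc (r * q) ^ σ = (r * q) ^ (σ - t) * (r * q) ^ t := by
        rw [← Real.rpow_add (by positivity), sub_add_cancel]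
    _ ≤ q ^ (s - t - η * d) * (r * q) ^ t := by gcongr
    _ = q ^ s * q ^ (-(η * d)) * r ^ t := by
        rw [Real.mul_rpow hr0.le hq.le, mul_comm (r ^ t), ← mul_assoc, ← Real.rpow_add hq,
          ← Real.rpow_add hq]
        ring_nf
    _ ≤ q ^ s * ℓ ^ d * (r / ℓ) ^ t := by gcongr

/-- The inequalities between the exponents under which reduced fractions whose denominators form a
set satisfying `IsDenominatorSet γ γ' q` are `t`-dimensionally spread out in every cube of side at
least `q ^ (-η)`. The spacing of the fractions with a fixed denominator is at most `q ^ (-κ)`. -/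
structure Exponents (γ γ' : ℝ) (β : Fin d → ℝ) (t κ η : ℝ) : Prop where
  dim_nonneg : 0 ≤ t
  dim_le : t ≤ d
  lt_spacing : η < κ
  spacing_le : ∀ j, κ ≤ γ' + β j
  weight_nonneg : ∀ j, 0 ≤ β j
  add_nonneg : ∀ j, 0 ≤ γ + β j
  add_le_one : ∀ j, γ + β j ≤ 1
  distinct_denominators : η * d ≤ (κ - η) * (d - t)
  same_denominator :
    (1 - κ) * (∑ j, (γ + β j) - t) ≤ countExponent γ' β - t - η * d
  loss_le : 0 ≤ countExponent γ' β - t - η * d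

theorem Exponents.rpow_spacing_le (he : Exponents γ γ' β t κ η) (h : IsDenominatorSet γ γ' q 𝓗)
    (hq : 1 ≤ q) (hH : H ∈ 𝓗) (j : Fin d) : q ^ κ ≤ H * q ^ β j :=
  calc q ^ κ ≤ q ^ (γ' + β j) := Real.rpow_le_rpow_of_exponent_le hq (he.spacing_le j)
    _ = q ^ γ' * q ^ β j := Real.rpow_add (by positivity) _ _
    _ ≤ H * q ^ β j := by
      have := h.rpow_le H hH
      gcongr

theorem Exponents.six_le_mul (he : Exponents γ γ' β t κ η) (h : IsDenominatorSet γ γ' q 𝓗)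
    (hq : 1 ≤ q) (hq6 : 6 ≤ q ^ (κ - η)) (hℓ : q ^ (-η) ≤ ℓ) (hH : H ∈ 𝓗) (j : Fin d) :
    6 ≤ H * q ^ β j * ℓ :=
  calc 6 ≤ q ^ (κ - η) := hq6
    _ = q ^ κ * q ^ (-η) := by rw [← Real.rpow_add (by positivity), sub_eq_add_neg]
    _ ≤ H * q ^ β j * ℓ :=
      mul_le_mul (he.rpow_spacing_le h hq hH j) hℓ (by positivity) (by positivity)

theorem Exponents.sum_mass_le_card (he : Exponents γ γ' β t κ η)
    (h : IsDenominatorSet γ γ' q 𝓗) (hq : 1 ≤ q) (hq6 : 6 ≤ q ^ (κ - η)) (hℓ : q ^ (-η) ≤ ℓ)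
    (c : Fin d → ℝ) :
    ∑ H ∈ 𝓗, mass (fun j => q ^ β j) ℓ H ≤
      4 ^ d * (fractions (fun j => q ^ β j) c ℓ 𝓗).card :=
  DiophantineLiminf.sum_mass_le_card (fun j => by positivity) h.one_or_prime
    (le_trans (by positivity) hℓ) fun _ hH j => he.six_le_mul h hq hq6 hℓ hH j

theorem Exponents.sum_prod_card_closePairs_le (he : Exponents γ γ' β t κ η)
    (h : IsDenominatorSet γ γ' q 𝓗) (hq : 1 ≤ q) (hq6 : 6 ≤ q ^ (κ - η)) (hℓ : q ^ (-η) ≤ ℓ)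
    (hℓ1 : ℓ ≤ 1) (hrq : q⁻¹ ≤ r) (hrℓ : r ≤ ℓ) :
    ∑ H ∈ 𝓗, ∑ H' ∈ 𝓗, ∏ j, ((closePairs (q ^ β j) (c j) ℓ r H H').card : ℝ) ≤
      2 * 6 ^ d * (∑ H ∈ 𝓗, mass (fun j => q ^ β j) ℓ H) ^ 2 * (r / ℓ) ^ t := by
  have hq0 : 0 < q := zero_lt_one.trans_le hq
  have hr0 : 0 < r := (inv_pos.2 hq0).trans_le hrq
  have hℓ0 : 0 < ℓ := hr0.trans_le hrℓ
  have hHℓ : ∀ H ∈ 𝓗, ∀ j, 1 ≤ H * q ^ β j * ℓ := fun H hH j =>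
    le_trans (by norm_num) (he.six_le_mul h hq hq6 hℓ hH j)
  rcases le_total (q ^ (-κ)) r with hlarge | hsmall
  · refine (sum_prod_card_closePairs_le_of_one_le_mul (fun j => by positivity)
      (fun H hH => h.pos hH) hr0 hrℓ he.dim_le hHℓ fun H hH j => ?_).trans ?_
    · calc (1 : ℝ) = q ^ (-κ) * q ^ κ := by
            rw [← Real.rpow_add hq0, neg_add_cancel, Real.rpow_zero]
        _ ≤ r * (H * q ^ β j) :=
            mul_le_mul hlarge (he.rpow_spacing_le h hq hH j) (by positivity) hr0.le
    · gcongr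
      linarith [show (0 : ℝ) < 6 ^ d by positivity]
  · have hrq' : 1 ≤ r * q := (inv_le_iff_one_le_mul₀ hq0).1 hrq
    refine h.sum_prod_card_closePairs_le he.weight_nonneg he.add_nonneg he.add_le_one hq hℓ0 hℓ1
      hr0 (hrℓ.trans hℓ1) hrq' hHℓ
      (div_pow_mul_inv_pow_le_div_rpow hq he.dim_le he.distinct_denominators hℓ hr0 hsmall) ?_
    exact (mul_rpow_le_rpow_mul_pow_mul_div_rpow hq he.dim_nonneg he.same_denominator
      he.loss_le hℓ hℓ1 hr0 hrq' hsmall).trans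
      (mul_le_mul_of_nonneg_right (h.rpow_le_sum_mass hq0 hℓ0.le) (by positivity))

open Classical in
theorem Exponents.sum_card_close_le (he : Exponents γ γ' β t κ η)
    (h : IsDenominatorSet γ γ' q 𝓗) (hq : 1 ≤ q) (hq6 : 6 ≤ q ^ (κ - η)) (hℓ : q ^ (-η) ≤ ℓ)
    (hℓ1 : ℓ ≤ 1) (hrq : q⁻¹ ≤ r) (hrℓ : r ≤ ℓ) (c : Fin d → ℝ) :
    ∑ a ∈ fractions (fun j => q ^ β j) c ℓ 𝓗,
        (((fractions (fun j => q ^ β j) c ℓ 𝓗).filter fun b =>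
          dist (fracPoint (fun j => q ^ β j) a.1 a.2) (fracPoint (fun j => q ^ β j) b.1 b.2) ≤
            r).card : ℝ) ≤
      2 * 96 ^ d * (fractions (fun j => q ^ β j) c ℓ 𝓗).card ^ 2 * (r / ℓ) ^ t := by
  have hr0 : 0 ≤ r := le_trans (by positivity) hrq
  have hℓ0 : 0 ≤ ℓ := hr0.trans hrℓ
  calc _ ≤ ∑ H ∈ 𝓗, ∑ H' ∈ 𝓗, ∏ j, ((closePairs (q ^ β j) (c j) ℓ r H H').card : ℝ) := by
        exact_mod_cast sum_card_close_le_sum_prod_closePairs (fun j => q ^ β j) c ℓ 𝓗 hr0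
    _ ≤ 2 * 6 ^ d * (∑ H ∈ 𝓗, mass (fun j => q ^ β j) ℓ H) ^ 2 * (r / ℓ) ^ t :=
        he.sum_prod_card_closePairs_le h hq hq6 hℓ hℓ1 hrq hrℓ
    _ ≤ 2 * 6 ^ d * (4 ^ d * (fractions (fun j => q ^ β j) c ℓ 𝓗).card) ^ 2 * (r / ℓ) ^ t := by
        gcongr 2 * 6 ^ d * ?_ ^ 2 * _
        · exact Finset.sum_nonneg fun H _ => mass_nonneg (fun j => by positivity) hℓ0 H
        · exact he.sum_mass_le_card h hq hq6 hℓ c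
    _ = 2 * (6 * 4 * 4) ^ d * (fractions (fun j => q ^ β j) c ℓ 𝓗).card ^ 2 * (r / ℓ) ^ t := by
        rw [mul_pow, mul_pow, mul_pow]
        ring
    _ = 2 * 96 ^ d * (fractions (fun j => q ^ β j) c ℓ 𝓗).card ^ 2 * (r / ℓ) ^ t := by norm_num

end Energy

section RegularSubsets

variable {ι X : Type*} [PseudoMetricSpace X] {P S : Finset ι} {y : ι → X}
  {A B ℓ δ r t τ : ℝ}

theorem card_le_two_mul_card_filter_le {Φ : ι → ℝ} (hΦ : ∀ a ∈ P, 0 ≤ Φ a) (hB : 0 < B)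
    (hsum : ∑ a ∈ P, Φ a ≤ B * P.card) :
    (P.card : ℝ) ≤ 2 * (P.filter fun a => Φ a ≤ 2 * B).card := by
  classical
  have hsplit : ((P.filter fun a => Φ a ≤ 2 * B).card : ℝ) +
      (P.filter fun a => ¬ Φ a ≤ 2 * B).card = P.card := by
    exact_mod_cast Finset.card_filter_add_card_filter_not (s := P) (fun a => Φ a ≤ 2 * B)
  have hmarkov : (P.filter fun a => ¬ Φ a ≤ 2 * B).card * (2 * B) ≤ B * P.card := by
    rw [← nsmul_eq_mul]
    refine (Finset.card_nsmul_le_sum _ Φ _ fun a ha =>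
      (not_le.1 (Finset.mem_filter.1 ha).2).le).trans (le_trans ?_ hsum)
    exact Finset.sum_le_sum_of_subset_of_nonneg (Finset.filter_subset _ P) fun a ha _ => hΦ a ha
  nlinarith

open Classical in
/-- The `τ`-energy of the point `y a` relative to the points `y b`, `b ∈ P`, summed over the dyadic
scales `ℓ / 2 ^ k`, `k ∈ K`. -/
noncomputable def dyadicEnergy (y : ι → X) (P : Finset ι) (ℓ τ : ℝ) (K : Finset ℕ) (a : ι) : ℝ :=
  ∑ k ∈ K, ((2 : ℝ) ^ k) ^ τ * (P.filter fun b => dist (y a) (y b) ≤ ℓ / 2 ^ k).card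

open Classical in
theorem sum_dyadicEnergy_le {K : Finset ℕ} (hA : 0 ≤ A) (hτt : τ < t) (hℓ : 0 < ℓ)
    (hpairs : ∀ k ∈ K, ∑ a ∈ P, ((P.filter fun b => dist (y a) (y b) ≤ ℓ / 2 ^ k).card : ℝ) ≤
      A * (ℓ / 2 ^ k / ℓ) ^ t) :
    ∑ a ∈ P, dyadicEnergy y P ℓ τ K a ≤ A * (1 - 2 ^ (τ - t))⁻¹ := by
  have hx1 : (2 : ℝ) ^ (τ - t) < 1 :=
    Real.rpow_lt_one_of_one_lt_of_neg one_lt_two (sub_neg.2 hτt)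
  have hscale : ∀ k ∈ K, ∑ a ∈ P, ((2 : ℝ) ^ k) ^ τ *
      ((P.filter fun b => dist (y a) (y b) ≤ ℓ / 2 ^ k).card : ℝ) ≤
        A * ((2 : ℝ) ^ (τ - t)) ^ k := by
    intro k hk
    have hratio : ℓ / 2 ^ k / ℓ = ((2 : ℝ) ^ k)⁻¹ := by field_simp
    calc ∑ a ∈ P, ((2 : ℝ) ^ k) ^ τ *
          ((P.filter fun b => dist (y a) (y b) ≤ ℓ / 2 ^ k).card : ℝ)
        ≤ ((2 : ℝ) ^ k) ^ τ * (A * (ℓ / 2 ^ k / ℓ) ^ t) := by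
          rw [← Finset.mul_sum]
          exact mul_le_mul_of_nonneg_left (hpairs k hk) (by positivity)
      _ = A * (((2 : ℝ) ^ k) ^ τ / ((2 : ℝ) ^ k) ^ t) := by
          rw [hratio, Real.inv_rpow (by positivity)]
          ring
      _ = A * ((2 : ℝ) ^ (τ - t)) ^ k := by
          rw [← Real.rpow_sub (by positivity), Real.rpow_pow_comm zero_le_two]
  simp only [dyadicEnergy]
  rw [Finset.sum_comm]
  refine (Finset.sum_le_sum hscale).trans ?_
  rw [← Finset.mul_sum, ← tsum_geometric_of_lt_one (by positivity) hx1]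
  exact mul_le_mul_of_nonneg_left ((summable_geometric_of_lt_one (by positivity) hx1).sum_le_tsum
    _ fun k _ => by positivity) hA

theorem finite_setOf_le_div_two_pow (hδ : 0 < δ) (ℓ : ℝ) : {k : ℕ | δ ≤ ℓ / 2 ^ k}.Finite := by
  refine (Set.finite_Iic ⌊ℓ / δ⌋₊).subset fun k (hk : δ ≤ ℓ / 2 ^ k) => Nat.le_floor ?_
  rw [le_div_iff₀ (by positivity)] at hk
  rw [le_div_iff₀ hδ]
  calc (k : ℝ) * δ ≤ 2 ^ k * δ := by
        gcongr
        exact_mod_cast Nat.lt_two_pow_self.le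
    _ ≤ ℓ := by linarith

/- By Markov's inequality at least half of the points have at most twice the mean energy. -/
open Classical in
theorem exists_regular_subset (y : ι → X) (hP : P.Nonempty) (hA : 0 < A) (hτt : τ < t)
    (hℓ : 0 < ℓ) (hδ : 0 < δ)
    (hpairs : ∀ r, δ ≤ r → r ≤ ℓ →
      ∑ a ∈ P, ((P.filter fun b => dist (y a) (y b) ≤ r).card : ℝ) ≤
        A * P.card ^ 2 * (r / ℓ) ^ t) :
    ∃ S ⊆ P, S.Nonempty ∧ ∀ a ∈ S, ∀ k : ℕ, δ ≤ ℓ / 2 ^ k →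
      ((S.filter fun b => dist (y a) (y b) ≤ ℓ / 2 ^ k).card : ℝ) ≤
        4 * A * (1 - 2 ^ (τ - t))⁻¹ * S.card * (((2 : ℝ) ^ k) ^ τ)⁻¹ := by
  let K : Finset ℕ := (finite_setOf_le_div_two_pow hδ ℓ).toFinset
  have hK : ∀ k ∈ K, δ ≤ ℓ / 2 ^ k := fun k hk =>
    (finite_setOf_le_div_two_pow hδ ℓ).mem_toFinset.1 hk
  let G : ℝ := (1 - 2 ^ (τ - t))⁻¹
  have hG : 0 < G := inv_pos.2 (sub_pos.2
    (Real.rpow_lt_one_of_one_lt_of_neg one_lt_two (sub_neg.2 hτt)))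
  have hP0 : (0 : ℝ) < P.card := Nat.cast_pos.2 hP.card_pos
  have hsum : ∑ a ∈ P, dyadicEnergy y P ℓ τ K a ≤ A * G * P.card * P.card :=
    (sum_dyadicEnergy_le (by positivity) hτt hℓ fun k hk =>
      hpairs _ (hK k hk)
        (div_le_self hℓ.le (one_le_pow₀ one_le_two))).trans_eq (by ring)
  let S : Finset ι := P.filter fun a => dyadicEnergy y P ℓ τ K a ≤ 2 * (A * G * P.card)
  have hS : (P.card : ℝ) ≤ 2 * S.card := card_le_two_mul_card_filter_le
    (fun a _ => Finset.sum_nonneg fun k _ => by positivity) (by positivity) hsum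
  have hS0 : (0 : ℝ) < S.card := by linarith
  refine ⟨S, Finset.filter_subset _ _, Finset.card_pos.1 (Nat.cast_pos.1 hS0), fun a ha k hk => ?_⟩
  rw [← div_eq_mul_inv, le_div_iff₀ (by positivity)]
  calc ((S.filter fun b => dist (y a) (y b) ≤ ℓ / 2 ^ k).card : ℝ) * ((2 : ℝ) ^ k) ^ τ
      ≤ ((2 : ℝ) ^ k) ^ τ * (P.filter fun b => dist (y a) (y b) ≤ ℓ / 2 ^ k).card := by
        rw [mul_comm]
        gcongr
        exact Finset.filter_subset _ _
    _ ≤ dyadicEnergy y P ℓ τ K a :=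
        Finset.single_le_sum (f := fun k => ((2 : ℝ) ^ k) ^ τ *
          ((P.filter fun b => dist (y a) (y b) ≤ ℓ / 2 ^ k).card : ℝ))
          (fun k _ => by positivity) ((finite_setOf_le_div_two_pow hδ ℓ).mem_toFinset.2 hk)
    _ ≤ 2 * (A * G * P.card) := (Finset.mem_filter.1 ha).2
    _ ≤ 2 * (A * G * (2 * S.card)) := by gcongr
    _ = 4 * A * G * S.card := by ring

theorem exists_le_div_two_pow (hr : 0 < r) (hrℓ : r ≤ ℓ) :
    ∃ k : ℕ, r ≤ ℓ / 2 ^ k ∧ ((2 : ℝ) ^ k)⁻¹ ≤ 2 * r / ℓ := by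
  have hℓ : 0 < ℓ := hr.trans_le hrℓ
  obtain ⟨k, hle, hlt⟩ := exists_nat_pow_near ((one_le_div hr).2 hrℓ) one_lt_two
  refine ⟨k, ?_, ?_⟩
  · rwa [le_div_comm₀ hr (by positivity)]
  · rw [div_lt_iff₀ hr, pow_succ] at hlt
    rw [inv_le_iff_one_le_mul₀ (by positivity), div_mul_eq_mul_div, one_le_div hℓ]
    linarith

theorem dist_le_of_closedBall_inter_nonempty {U : Set X} (hU : ∀ u ∈ U, ∀ v ∈ U, dist u v ≤ r)
    {z z' : X} (hz : (Metric.closedBall z δ ∩ U).Nonempty)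
    (hz' : (Metric.closedBall z' δ ∩ U).Nonempty) : dist z z' ≤ δ + r + δ := by
  obtain ⟨u, hu, huU⟩ := hz
  obtain ⟨v, hv, hvU⟩ := hz'
  exact (dist_triangle4 z u v z').trans
    (add_le_add_three (Metric.mem_closedBall'.1 hu) (hU u huU v hvU) (Metric.mem_closedBall.1 hv))

open Classical in
theorem card_filter_meets_le (ht : 0 ≤ t) (hℓ : 0 < ℓ)
    (hreg : ∀ a ∈ S, ∀ k : ℕ, δ ≤ ℓ / 2 ^ k →
      ((S.filter fun b => dist (y a) (y b) ≤ ℓ / 2 ^ k).card : ℝ) ≤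
        B * S.card * (((2 : ℝ) ^ k) ^ t)⁻¹)
    {U : Set X} (hr : 0 < r) (hU : ∀ u ∈ U, ∀ v ∈ U, dist u v ≤ r) :
    ((S.filter fun a => (Metric.closedBall (y a) δ ∩ U).Nonempty).card : ℝ) ≤
      6 ^ t * max 1 B * S.card * (max r δ / ℓ) ^ t := by
  let R : ℝ := max r δ
  have hR : 0 < R := lt_max_of_lt_left hr
  let T : Finset ι := S.filter fun a => (Metric.closedBall (y a) δ ∩ U).Nonempty
  have hscale : 6 ^ t * max 1 B * S.card * (R / ℓ) ^ t =
      max 1 B * S.card * (2 * (3 * R) / ℓ) ^ t := by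
    rw [show 2 * (3 * R) / ℓ = 6 * (R / ℓ) by ring, Real.mul_rpow (by norm_num) (by positivity)]
    ring
  change (T.card : ℝ) ≤ 6 ^ t * max 1 B * S.card * (R / ℓ) ^ t
  rw [hscale]
  have hB : (1 : ℝ) ≤ max 1 B := le_max_left _ _
  rcases T.eq_empty_or_nonempty with hT | ⟨a, ha⟩
  · rw [hT, Finset.card_empty, Nat.cast_zero]
    positivity
  rcases lt_or_ge ℓ (3 * R) with hlarge | hsmall
  · have hone : 1 ≤ (2 * (3 * R) / ℓ) ^ t :=
      Real.one_le_rpow ((one_le_div hℓ).2 (by linarith)) ht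
    calc (T.card : ℝ) ≤ 1 * S.card * 1 := by
          rw [one_mul, mul_one]
          exact_mod_cast Finset.card_filter_le _ _
      _ ≤ max 1 B * S.card * (2 * (3 * R) / ℓ) ^ t := by gcongr
  · obtain ⟨k, hk, hk'⟩ := exists_le_div_two_pow (by positivity) hsmall
    have hδR : δ ≤ R := le_max_right _ _
    have hrR : r ≤ R := le_max_left _ _
    have hsub : T ⊆ S.filter fun b => dist (y a) (y b) ≤ ℓ / 2 ^ k := fun b hb =>
      Finset.mem_filter.2 ⟨(Finset.mem_filter.1 hb).1, (dist_le_of_closedBall_inter_nonempty hU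
        (Finset.mem_filter.1 ha).2 (Finset.mem_filter.1 hb).2).trans (by linarith)⟩
    calc (T.card : ℝ) ≤ (S.filter fun b => dist (y a) (y b) ≤ ℓ / 2 ^ k).card := by
          exact_mod_cast Finset.card_le_card hsub
      _ ≤ B * S.card * (((2 : ℝ) ^ k) ^ t)⁻¹ :=
          hreg a (Finset.mem_filter.1 ha).1 k (by linarith)
      _ ≤ max 1 B * S.card * (2 * (3 * R) / ℓ) ^ t := by
          rw [← Real.inv_rpow (by positivity)]
          gcongr
          exact le_max_right _ _

open Classical in
theorem hasChildren_of_card_le (hS : S.Nonempty) (ht : 0 ≤ t) (hℓ : 0 < ℓ) (hδℓ : δ ≤ ℓ / 2)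
    (hreg : ∀ a ∈ S, ∀ k : ℕ, δ ≤ ℓ / 2 ^ k →
      ((S.filter fun b => dist (y a) (y b) ≤ ℓ / 2 ^ k).card : ℝ) ≤
        B * S.card * (((2 : ℝ) ^ k) ^ t)⁻¹)
    {F : Set X} {c : X} (hc : ∀ a ∈ S, dist (y a) c ≤ ℓ / 2)
    (hF : ∀ a ∈ S, Metric.closedBall (y a) δ ⊆ F) :
    HasChildren ι (6 ^ t * max 1 B) t ℓ δ F c :=
  ⟨S, y, hS, fun a ha => subset_inter
    (Metric.closedBall_subset_closedBall' (by linarith [hc a ha])) (hF a ha),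
    fun _ _ hr hU => card_filter_meets_le ht hℓ hreg hr hU⟩

end RegularSubsets

section Children

variable {d : ℕ} {β c : Fin d → ℝ} {γ γ' t τ κ η q ℓ : ℝ} {𝓗 : Finset ℕ}

theorem Exponents.fractions_nonempty (he : Exponents γ γ' β t κ η)
    (h : IsDenominatorSet γ γ' q 𝓗) (hq : 1 ≤ q) (hq6 : 6 ≤ q ^ (κ - η)) (hℓ : q ^ (-η) ≤ ℓ)
    (c : Fin d → ℝ) : (fractions (fun j => q ^ β j) c ℓ 𝓗).Nonempty := by
  have hq0 : 0 < q := zero_lt_one.trans_le hq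
  have hℓ0 : 0 < ℓ := (Real.rpow_pos_of_pos hq0 _).trans_le hℓ
  have hcard : (0 : ℝ) < 4 ^ d * (fractions (fun j => q ^ β j) c ℓ 𝓗).card :=
    calc 0 < q ^ countExponent γ' β * ℓ ^ d := by positivity
      _ ≤ ∑ H ∈ 𝓗, mass (fun j => q ^ β j) ℓ H := h.rpow_le_sum_mass hq0 hℓ0.le
      _ ≤ 4 ^ d * (fractions (fun j => q ^ β j) c ℓ 𝓗).card := he.sum_mass_le_card h hq hq6 hℓ c
  exact Finset.card_pos.1 (Nat.cast_pos.1 (pos_of_mul_pos_right hcard (by positivity)))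

theorem dist_fracPoint_le {w : Fin d → ℝ} (hw : ∀ j, 0 < w j) (h𝓗 : ∀ H ∈ 𝓗, 0 < H)
    (hℓ : 0 ≤ ℓ) {a : Σ _ : ℕ, Fin d → ℤ} (ha : a ∈ fractions w c ℓ 𝓗) :
    dist (fracPoint w a.1 a.2) c ≤ ℓ / 2 := by
  obtain ⟨hH, hp⟩ := Finset.mem_sigma.1 ha
  exact (dist_pi_le_iff (by positivity)).2 fun j =>
    (Real.dist_eq _ _).trans_le
      ((mem_numerators (hw j) (h𝓗 _ hH)).1 (Fintype.mem_piFinset.1 hp j)).1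

theorem IsDenominatorSet.closedBall_fracPoint_subset_cubeLevel
    (h : IsDenominatorSet γ γ' q 𝓗) {a : Σ _ : ℕ, Fin d → ℤ}
    (ha : a ∈ fractions (fun j => q ^ β j) c ℓ 𝓗) :
    Metric.closedBall (fracPoint (fun j => q ^ β j) a.1 a.2) q⁻¹ ⊆ cubeLevel γ β q := fun _ hx =>
  have hH := (Finset.mem_sigma.1 ha).1
  ⟨a.1, h.pos hH, h.le_rpow _ hH, a.2, hx⟩

theorem Exponents.hasChildren (he : Exponents γ γ' β t κ η) (hτ : 0 ≤ τ) (hτt : τ < t)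
    (h : IsDenominatorSet γ γ' q 𝓗) (hq : 1 ≤ q) (hq6 : 6 ≤ q ^ (κ - η)) (hℓ : q ^ (-η) ≤ ℓ)
    (hℓ1 : ℓ ≤ 1) (hqℓ : q⁻¹ ≤ ℓ / 2) (c : Fin d → ℝ) :
    HasChildren (Σ _ : ℕ, Fin d → ℤ)
      (6 ^ τ * max 1 (4 * (2 * 96 ^ d) * (1 - 2 ^ (τ - t))⁻¹)) τ ℓ q⁻¹ (cubeLevel γ β q) c := by
  have hq0 : 0 < q := zero_lt_one.trans_le hq
  have hℓ0 : 0 < ℓ := (Real.rpow_pos_of_pos hq0 _).trans_le hℓ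
  obtain ⟨S, hSP, hS, hreg⟩ := exists_regular_subset
    (fun a : Σ _ : ℕ, Fin d → ℤ => fracPoint (fun j => q ^ β j) a.1 a.2)
    (he.fractions_nonempty h hq hq6 hℓ c) (A := 2 * 96 ^ d) (by positivity) hτt hℓ0
    (inv_pos.2 hq0) fun r hqr hrℓ => he.sum_card_close_le h hq hq6 hℓ hℓ1 hqr hrℓ c
  exact hasChildren_of_card_le hS hτ hℓ0 hqℓ hreg
    (fun a ha => dist_fracPoint_le (fun j => by positivity) (fun H hH => h.pos hH) hℓ0.le (hSP ha))
    fun a ha => h.closedBall_fracPoint_subset_cubeLevel (hSP ha)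

end Children

section ExponentChoice

variable {d : ℕ} {γ γ' t : ℝ} {β : Fin d → ℝ}

theorem exists_exponents_of_lt (ht : 0 ≤ t) (htd : t < d) (hβ : ∀ j, 0 ≤ β j)
    (hγβ : ∀ j, 0 ≤ γ + β j ∧ γ + β j ≤ 1) (hγ'β : ∀ j, 0 < γ' + β j)
    (hγγ' : d * γ ≤ (d + 1) * γ') (hts : t < countExponent γ' β) :
    ∃ κ η, 0 < η ∧ Exponents γ γ' β t κ η := by
  have hspacing : ∀ᶠ κ : ℝ in 𝓝[>] 0, ∀ j, κ < γ' + β j :=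
    eventually_all.2 fun j => nhdsWithin_le_nhds (eventually_lt_nhds (hγ'β j))
  obtain ⟨κ, ⟨hκβ, hκ1⟩, hκ⟩ := ((hspacing.and (nhdsWithin_le_nhds
    (eventually_lt_nhds one_pos))).and (self_mem_nhdsWithin (s := Ioi 0))).exists
  have hsum : ∑ j, (γ + β j) ≤ countExponent γ' β := by
    simp only [Finset.sum_add_distrib, Finset.sum_const, Finset.card_univ, Fintype.card_fin,
      nsmul_eq_mul, countExponent]
    linarith
  have hsame : (1 - κ) * (∑ j, (γ + β j) - t) < countExponent γ' β - t :=
    calc (1 - κ) * (∑ j, (γ + β j) - t) ≤ (1 - κ) * (countExponent γ' β - t) := by gcongr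
      _ < countExponent γ' β - t :=
          mul_lt_of_lt_one_left (sub_pos.2 hts) (sub_lt_self 1 hκ)
  have hsmall : ∀ᶠ η : ℝ in 𝓝 0, η < κ ∧ η * d < (κ - η) * (d - t) ∧
      (1 - κ) * (∑ j, (γ + β j) - t) < countExponent γ' β - t - η * d ∧
      0 < countExponent γ' β - t - η * d :=
    (eventually_lt_nhds hκ).and <|
      (ContinuousAt.eventually_lt (by fun_prop) (by fun_prop)
        (by simpa using mul_pos hκ (sub_pos.2 htd))).and <|
      (ContinuousAt.eventually_lt (by fun_prop) (by fun_prop) (by simpa using hsame)).and <|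
      ContinuousAt.eventually_lt (by fun_prop) (by fun_prop) (by simpa using hts)
  obtain ⟨η, ⟨hηκ, hdistinct, hsame', hloss⟩, hη⟩ :=
    ((hsmall.filter_mono nhdsWithin_le_nhds).and (self_mem_nhdsWithin (s := Ioi 0))).exists
  exact ⟨κ, η, hη,
    { dim_nonneg := ht
      dim_le := htd.le
      lt_spacing := hηκ
      spacing_le := fun j => (hκβ j).le
      weight_nonneg := hβ
      add_nonneg := fun j => (hγβ j).1
      add_le_one := fun j => (hγβ j).2
      distinct_denominators := hdistinct.le
      same_denominator := hsame'.le
      loss_le := hloss.le }⟩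

theorem exists_denominatorExponent (hγ : 0 ≤ γ) (hγβ : ∀ j, 0 < γ + β j)
    (hts : t < countExponent γ β) :
    ∃ γ', (∀ j, 0 < γ' + β j) ∧ d * γ ≤ (d + 1) * γ' ∧ t < countExponent γ' β ∧
      ∀ᶠ q : ℝ in atTop, ∃ 𝓗, IsDenominatorSet γ γ' q 𝓗 := by
  rcases hγ.eq_or_lt with rfl | hγ
  · exact ⟨0, hγβ, by simp, hts,
      Eventually.of_forall fun q => ⟨{1}, isDenominatorSet_singleton_one q⟩⟩
  · have hclose : ∀ᶠ γ' in 𝓝 γ, 0 < γ' ∧ (∀ j, 0 < γ' + β j) ∧ d * γ < (d + 1) * γ' ∧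
        t < countExponent γ' β :=
      (eventually_gt_nhds hγ).and <|
        (eventually_all.2 fun j =>
          ContinuousAt.eventually_lt (by fun_prop) (by fun_prop) (hγβ j)).and <|
        (ContinuousAt.eventually_lt (by fun_prop) (by fun_prop) (by linarith)).and <|
        ContinuousAt.eventually_lt (by fun_prop) (by unfold countExponent; fun_prop) hts
    obtain ⟨γ', ⟨hγ', hγ'β, hγγ', hts'⟩, hlt⟩ :=
      ((hclose.filter_mono nhdsWithin_le_nhds).and (self_mem_nhdsWithin (s := Iio γ))).exists
    exact ⟨γ', hγ'β, hγγ'.le, hts', eventually_exists_isDenominatorSet hγ' hlt⟩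

end ExponentChoice

section Growth

variable {d : ℕ} {γ : ℝ} {β : Fin d → ℝ} {q : ℕ → ℝ}

theorem GrowsFast.eventually_pow_le_succ (hd : 1 ≤ d) (h : GrowsFast γ β q) (N : ℕ) :
    ∀ᶠ i in atTop, q i ^ N ≤ q (i + 1) := by
  filter_upwards [eventually_ge_atTop N, eventually_ge_atTop 1] with i hN hi
  exact (pow_le_pow_right₀ (h.1 i hi).le (by nlinarith)).trans (h.2.2 i hi).1.le

theorem GrowsFast.tendsto_atTop (hd : 1 ≤ d) (h : GrowsFast γ β q) : Tendsto q atTop atTop := by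
  have hq1 : 1 < q 1 := h.1 1 le_rfl
  have hpow : ∀ n, q 1 ^ (n + 1) ≤ q (n + 1) := by
    intro n
    induction n with
    | zero => simp
    | succ n ih =>
      calc q 1 ^ (n + 1 + 1) ≤ (q 1 ^ (n + 1)) ^ 2 := by
            rw [← pow_mul]
            exact pow_le_pow_right₀ hq1.le (by lia)
        _ ≤ q (n + 1) ^ 2 := by gcongr
        _ ≤ q (n + 1) ^ (10 * d * (n + 1 + 1)) :=
            pow_le_pow_right₀ (h.1 (n + 1) (by lia)).le (by nlinarith)
        _ ≤ q (n + 1 + 1) := (h.2.2 (n + 1) (by lia)).1.le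
  rw [← tendsto_add_atTop_iff_nat 1]
  exact tendsto_atTop_mono hpow
    ((tendsto_add_atTop_iff_nat 1).2 (tendsto_pow_atTop_atTop_of_one_lt hq1))

theorem exists_growsFast (γ : ℝ) (β : Fin d → ℝ) : ∃ q : ℕ → ℝ, GrowsFast γ β q := by
  have hnext : ∀ (i : ℕ) (x : ℝ), ∃ y, x < y ∧ x ^ (10 * d * (i + 1)) < y ∧
      ∀ j, x ^ (1 / (γ + β j)) < y := fun i x =>
    ((eventually_gt_atTop x).and ((eventually_gt_atTop _).and
      (eventually_all.2 fun j => eventually_gt_atTop _))).exists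
  choose F hlt hF using hnext
  let q : ℕ → ℝ := fun n => Nat.rec 2 F n
  have hmono : StrictMono q := strictMono_nat_of_lt_succ fun i => hlt i (q i)
  have hone : ∀ i, 1 < q i := fun i => one_lt_two.trans_le (hmono.monotone i.zero_le)
  exact ⟨q, fun i _ => hone i, hmono.strictMonoOn _, fun i _ => hF i (q i)⟩

theorem eventually_rpow_neg_succ_le_inv {η : ℝ} (hη : 0 < η) (hq : Tendsto q atTop atTop)
    (hgrow : ∀ N : ℕ, ∀ᶠ i in atTop, q i ^ N ≤ q (i + 1)) :
    ∀ᶠ i in atTop, q (i + 1) ^ (-η) ≤ (q i)⁻¹ := by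
  obtain ⟨N, hN⟩ := exists_nat_ge (1 / η)
  rw [div_le_iff₀ hη] at hN
  filter_upwards [hq.eventually_ge_atTop 1, hgrow N] with i hqi hpow
  have hqi0 : 0 < q i := one_pos.trans_le hqi
  rw [Real.rpow_neg ((pow_pos hqi0 N).trans_le hpow).le]
  refine inv_anti₀ hqi0 ?_
  calc q i ≤ q i ^ (N * η) := Real.self_le_rpow_of_one_le hqi hN
    _ = (q i ^ N) ^ η := by rw [Real.rpow_mul hqi0.le, Real.rpow_natCast]
    _ ≤ q (i + 1) ^ η := by gcongr

theorem tendsto_inv_succ_div_inv (hq : Tendsto q atTop atTop)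
    (hsq : ∀ᶠ i in atTop, q i ^ 2 ≤ q (i + 1)) :
    Tendsto (fun i => (q (i + 1))⁻¹ / (q i)⁻¹) atTop (𝓝 0) := by
  refine squeeze_zero' ?_ ?_ (tendsto_inv_atTop_zero.comp hq)
  · filter_upwards [hq.eventually_gt_atTop 0, hsq] with i hqi hsqi
    have : 0 < q (i + 1) := (pow_pos hqi 2).trans_le hsqi
    positivity
  · filter_upwards [hq.eventually_gt_atTop 0, hsq] with i hqi hsqi
    rw [div_le_iff₀ (inv_pos.2 hqi), Function.comp_apply, ← mul_inv, ← sq]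
    exact inv_anti₀ (pow_pos hqi 2) hsqi

end Growth

section Dimension

variable {d : ℕ} {γ τ : ℝ} {β : Fin d → ℝ} {q : ℕ → ℝ}

theorem exists_eventually_hasChildren (hγ : 0 ≤ γ) (hβ : ∀ j, 0 ≤ β j)
    (hγβ : ∀ j, 0 < γ + β j ∧ γ + β j ≤ 1) (hq : Tendsto q atTop atTop)
    (hgrow : ∀ N : ℕ, ∀ᶠ i in atTop, q i ^ N ≤ q (i + 1)) (hτ : 0 ≤ τ)
    (hτs : τ < countExponent γ β) (hτd : τ < d) :
    ∃ C, 1 ≤ C ∧ ∀ᶠ i in atTop, ∀ c, HasChildren (Σ _ : ℕ, Fin d → ℤ) C τ (q i)⁻¹ (q (i + 1))⁻¹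
      (cubeLevel γ β (q (i + 1))) c := by
  obtain ⟨t, hτt, ht⟩ := exists_between (lt_min hτs hτd)
  obtain ⟨hts, htd⟩ := lt_min_iff.1 ht
  obtain ⟨γ', hγ'β, hγγ', hts', hden⟩ :=
    exists_denominatorExponent hγ (fun j => (hγβ j).1) hts
  obtain ⟨κ, η, hη, he⟩ := exists_exponents_of_lt (hτ.trans hτt.le) htd hβ
    (fun j => ⟨(hγβ j).1.le, (hγβ j).2⟩) hγ'β hγγ' hts'
  refine ⟨6 ^ τ * max 1 (4 * (2 * 96 ^ d) * (1 - 2 ^ (τ - t))⁻¹), one_le_mul_of_one_le_of_one_le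
    (Real.one_le_rpow (by norm_num) hτ) (le_max_left _ _), ?_⟩
  have hsucc : Tendsto (fun i => q (i + 1)) atTop atTop := (tendsto_add_atTop_iff_nat 1).2 hq
  filter_upwards [hsucc.eventually hden,
    hsucc.eventually ((tendsto_rpow_atTop (sub_pos.2 he.lt_spacing)).eventually_ge_atTop 6),
    eventually_rpow_neg_succ_le_inv hη hq hgrow, hq.eventually_ge_atTop 2, hgrow 2]
    with i ⟨𝓗, h𝓗⟩ hsix hside htwo hsq c
  refine he.hasChildren hτ hτt h𝓗 (by nlinarith) hsix hside
    (inv_le_one_of_one_le₀ (by linarith)) ?_ c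
  rw [div_eq_mul_inv, ← mul_inv]
  exact inv_anti₀ (by positivity) (by nlinarith)

/- The levels up to `n` impose no condition near the origin, because of the fraction `0 / 1`. -/
theorem closedBall_inter_iInter_cubeLevel_subset (hγ : 0 ≤ γ) (hq : ∀ i, 1 ≤ i → 1 ≤ q i) {n : ℕ}
    (hmax : ∀ i ≤ n, q i ≤ q n) :
    Metric.closedBall 0 (q n)⁻¹ ∩ ⋂ k, cubeLevel γ β (q (n + k + 1)) ⊆ cubeSet γ β q := by
  rintro x ⟨hx, hlevels⟩
  refine mem_iInter₂.2 fun i hi => ?_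
  have hqi : 1 ≤ q i := hq i hi
  rcases le_or_gt i n with hin | hin
  · refine ⟨1, le_rfl, by simpa using Real.one_le_rpow hqi hγ, 0, ?_⟩
    have hzero : fracPoint (fun j => q i ^ β j) 1 0 = 0 := by ext j; simp [fracPoint]
    rw [hzero]
    exact Metric.closedBall_subset_closedBall (inv_anti₀ (by linarith) (hmax i hin)) hx
  · obtain ⟨k, rfl⟩ := Nat.exists_eq_add_of_lt hin
    exact mem_iInter.1 hlevels k

theorem le_dimH_cubeSet (hγ : 0 ≤ γ) (hβ : ∀ j, 0 ≤ β j)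
    (hγβ : ∀ j, 0 < γ + β j ∧ γ + β j ≤ 1) (hq1 : ∀ i, 1 ≤ i → 1 ≤ q i)
    (hq : Tendsto q atTop atTop) (hgrow : ∀ N : ℕ, ∀ᶠ i in atTop, q i ^ N ≤ q (i + 1))
    (hτ : 0 < τ) (hτs : τ < countExponent γ β) (hτd : τ < d) :
    ENNReal.ofReal τ ≤ dimH (cubeSet γ β q) := by
  obtain ⟨t, hτt, ht⟩ := exists_between (lt_min hτs hτd)
  obtain ⟨hts, htd⟩ := lt_min_iff.1 ht
  obtain ⟨C, hC, hchildren⟩ :=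
    exists_eventually_hasChildren hγ hβ hγβ hq hgrow (hτ.trans hτt).le hts htd
  have hratio : Tendsto (fun i => C * ((q (i + 1))⁻¹ / (q i)⁻¹) ^ (t - τ)) atTop (𝓝 0) := by
    simpa [Real.zero_rpow (sub_pos.2 hτt).ne'] using
      ((tendsto_inv_succ_div_inv hq (hgrow 2)).rpow_const
        (Or.inr (sub_pos.2 hτt).le)).const_mul C
  obtain ⟨n, hmax, hn⟩ := ((frequently_high_scores hq).and_eventually
    (eventually_forall_ge_atTop.2 (hchildren.and ((hratio.eventually_le_const one_pos).and
      (hq.eventually_gt_atTop 0))))).exists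
  have hne : μH[τ] (Metric.closedBall 0 (q n)⁻¹ ∩
      ⋂ k, cubeLevel γ β (q (n + k + 1))) ≠ 0 :=
    hausdorffMeasure_ne_zero_of_hasChildren (ρ := fun k => (q (n + k))⁻¹) hC hτ hτt.le
      (fun k => inv_pos.2 (hn (n + k) (n.le_add_right k)).2.2)
      (tendsto_inv_atTop_zero.comp <| hq.comp
        (tendsto_atTop_mono (fun k => k.le_add_left n) tendsto_id))
      (fun k => (hn (n + k) (n.le_add_right k)).2.1)
      (fun k => (hn (n + k) (n.le_add_right k)).1) 0
  have hle : ENNReal.ofReal τ ≤ dimH (Metric.closedBall 0 (q n)⁻¹ ∩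
      ⋂ k, cubeLevel γ β (q (n + k + 1))) :=
    le_dimH_of_hausdorffMeasure_ne_zero (by rwa [Real.coe_toNNReal _ hτ.le])
  exact hle.trans (dimH_mono (closedBall_inter_iInter_cubeLevel_subset hγ hq1 fun i hi =>
    hi.eq_or_lt.elim (fun h => h ▸ le_rfl) fun h => (hmax i h).le))

theorem dimH_cubeSet (hγ : 0 ≤ γ) (hβ : ∀ j, 0 ≤ β j)
    (hγβ : ∀ j, 0 < γ + β j ∧ γ + β j ≤ 1) (hq1 : ∀ i, 1 ≤ i → 1 ≤ q i)
    (hq : Tendsto q atTop atTop) (hgrow : ∀ N : ℕ, ∀ᶠ i in atTop, q i ^ N ≤ q (i + 1)) :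
    dimH (cubeSet γ β q) = ENNReal.ofReal (min (countExponent γ β) d) := by
  refine le_antisymm ?_ (le_of_forall_lt_imp_le_of_dense fun a ha => ?_)
  · have hs : 0 ≤ countExponent γ β :=
      add_nonneg (by positivity) (Finset.sum_nonneg fun j _ => hβ j)
    rw [ENNReal.ofReal_min, ENNReal.ofReal_natCast]
    exact le_min (dimH_cubeSet_le hs (fun j => (hγβ j).1.le) hq)
      ((dimH_mono (subset_univ _)).trans_eq (Real.dimH_univ_pi_fin d))
  · lift a to ℝ≥0 using ha.ne_top
    rcases eq_zero_or_pos a with rfl | ha0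
    · exact zero_le
    rw [← ENNReal.ofReal_coe_nnreal] at ha ⊢
    obtain ⟨hs, hd⟩ := lt_min_iff.1
      ((ENNReal.ofReal_lt_ofReal_iff_of_nonneg a.coe_nonneg).1 ha)
    exact le_dimH_cubeSet hγ hβ hγβ hq1 hq hgrow ha0 hs hd

end Dimension

end DiophantineLiminf

theorem theorem1p1_general {d : ℕ} {γ : ℝ} {β : Fin d → ℝ} {q : ℕ → ℝ}
    (hγ : 0 ≤ γ) (hβ : ∀ j, 0 ≤ β j) (hγβ : ∀ j, 0 < γ + β j ∧ γ + β j ≤ 1)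
    (hq1 : ∀ i, 1 ≤ i → 1 ≤ q i) (hq : Tendsto q atTop atTop)
    (hgrow : ∀ N : ℕ, ∀ᶠ i in atTop, q i ^ N ≤ q (i + 1)) :
    dimH (DiophantineLiminf.approxSet γ β q) =
      ENNReal.ofReal (min (((d : ℝ) + 1) * γ + ∑ j, β j) (d : ℝ)) := by
  rw [DiophantineLiminf.dimH_approxSet fun i hi => one_pos.trans_le (hq1 i hi)]
  exact DiophantineLiminf.dimH_cubeSet hγ hβ hγβ hq1 hq hgrow

theorem theorem1p1 (d : ℕ) (hd : 1 ≤ d) (γ : ℝ) (β : Fin d → ℝ)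
    (hγ : 0 ≤ γ) (hβ : ∀ j, 0 ≤ β j) (hγβ : ∀ j, 0 < γ + β j ∧ γ + β j < 1) :
    -- the two descriptions of the set agree
    (∀ q : ℕ → ℝ, (∀ i, 1 ≤ i → 0 < q i) →
      DiophantineLiminf.approxSet γ β q = DiophantineLiminf.latticeSet γ β q) ∧
    -- some increasing sequence of positive reals gives the stated dimension
    (∃ q : ℕ → ℝ, (∀ i, 1 ≤ i → 0 < q i) ∧ StrictMonoOn q (Set.Ici 1) ∧
      dimH (DiophantineLiminf.approxSet γ β q) =
        ENNReal.ofReal (min (((d : ℝ) + 1) * γ + ∑ j, β j) (d : ℝ))) ∧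
    -- every sequence that satisfies the growth condition does
    (∀ q : ℕ → ℝ, DiophantineLiminf.GrowsFast γ β q →
      dimH (DiophantineLiminf.approxSet γ β q) =
        ENNReal.ofReal (min (((d : ℝ) + 1) * γ + ∑ j, β j) (d : ℝ))) := by
  have hdim : ∀ q, DiophantineLiminf.GrowsFast γ β q → dimH (DiophantineLiminf.approxSet γ β q) =
      ENNReal.ofReal (min (((d : ℝ) + 1) * γ + ∑ j, β j) (d : ℝ)) := fun q h =>
    theorem1p1_general hγ hβ (fun j => ⟨(hγβ j).1, (hγβ j).2.le⟩) (fun i hi => (h.1 i hi).le)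
      (h.tendsto_atTop hd) (h.eventually_pow_le_succ hd)
  obtain ⟨q, hq⟩ := DiophantineLiminf.exists_growsFast γ β
  exact ⟨fun _ => DiophantineLiminf.approxSet_eq_latticeSet,
    ⟨q, fun i hi => one_pos.trans (hq.1 i hi), hq.2.1, hdim q hq⟩, hdim⟩
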